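/- Let $c,d\ge 0$ and $n\ge 1$ be integers, let $\mathcal G_{c,d}=\mathrm{diag}(\mathbf 1_c,-\mathbf 1_d)$, and let $\mathrm U(c,d)$ be the group of complex $(c+d)\times(c+d)$ matrices $T$ with $T^*\mathcal G_{c,d}T=\mathcal G_{c,d}$. For $z\in\mathbb C$ put $B(z)=\mathrm{diag}(z\mathbf 1_c,\mathbf 1_d)$, and for $T_1,\dots,T_n\in \mathrm U(c,d)$ put $$D(z)=B(z)T_1\,B(z)T_2\cdots B(z)T_n .$$ Let $\mathbb D=\{z\in\mathbb C:|z|<1\}$, let $G(d,c+d)$ be the complex manifold of $d$-dimensional subspaces of $\mathbb C^{c+d}$, and let $\rho$ denote the spectral radius. Then there is a holomorphic map $W:\mathbb D\to G(d,c+d)$ such that for every $z\in\mathbb D$: (i) $W(z)$ is invariant under $D(z)$; (ii) $W(z)$ is associated with the $d$ eigenvalues of $D(z)$ of largest absolute value (counted with algebraic multiplicity): there is a real number $r$ such that $W(z)$ is the sum of the generalized eigenspaces of $D(z)$ for the eigenvalues $\mu$ with $|\mu|>r$; (iii) the restriction $D_W(z)=D(z)|_{W(z)}$ is invertible and $\ln\rho(\Lambda^dD(z))=\ln|\det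 D_W(z)|$. Moreover $\rho(\Lambda^dD(z))>0$ for all $z\in\overline{\mathbb D}$, and the function $z\mapsto\ln\rho(\Lambda^dD(z))$ is harmonic on $\mathbb D$ and continuous on $\overline{\mathbb D}$. -/

import Mathlib

open Topology

/-- The matrix `diag(1_c, -1_d)` of the standard Hermitian form of signature `(c,d)`. -/
def signatureMatrix (c d : ℕ) : Matrix (Fin c ⊕ Fin d) (Fin c ⊕ Fin d) ℂ :=
  Matrix.fromBlocks 1 0 0 (-1)

/-- The pseudo-unitary group `U(c,d)`, as a set of matrices. -/
def pseudoUnitary (c d : ℕ) : Set (Matrix (Fin c ⊕ Fin d) (Fin c ⊕ Fin d) ℂ) :=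
  {T | T.conjTranspose * signatureMatrix c d * T = signatureMatrix c d}

/-- The matrix `B(z) = diag(z 1_c, 1_d)`. -/
def scalingMatrix (c d : ℕ) (z : ℂ) : Matrix (Fin c ⊕ Fin d) (Fin c ⊕ Fin d) ℂ :=
  Matrix.fromBlocks (z • 1) 0 0 1

/-- The ordered product `D(z) = B(z) T_1 B(z) T_2 ⋯ B(z) T_n`. -/
def cocycleMatrix {c d n : ℕ} (T : Fin n → Matrix (Fin c ⊕ Fin d) (Fin c ⊕ Fin d) ℂ) (z : ℂ) :
    Matrix (Fin c ⊕ Fin d) (Fin c ⊕ Fin d) ℂ :=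
  (List.ofFn fun j => scalingMatrix c d z * T j).prod

/-- The product `D(z)` as an endomorphism of `ℂ^(c+d)`. -/
noncomputable def cocycleEnd {c d n : ℕ}
    (T : Fin n → Matrix (Fin c ⊕ Fin d) (Fin c ⊕ Fin d) ℂ) (z : ℂ) :
    Module.End ℂ (Fin c ⊕ Fin d → ℂ) :=
  Matrix.toLin' (cocycleMatrix T z)

/-- The spectral radius of the `k`-th exterior power of `f`, as a real number. -/
noncomputable def exteriorSpectralRadius {V : Type*} [AddCommGroup V] [Module ℂ V] (k : ℕ)
    (f : Module.End ℂ V) : ℝ :=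
  (spectralRadius ℂ (exteriorPower.map k f : Module.End ℂ (⋀[ℂ]^k V))).toReal

/-- The Grassmannian `G(d,c+d)` of `d`-dimensional subspaces of `ℂ^(c+d)`. -/
def Grassmannian (c d : ℕ) : Type :=
  {V : Submodule ℂ (Fin c ⊕ Fin d → ℂ) // Module.finrank ℂ V = d}

/-- The linear map `ℂ^d → ℂ^(c+d)` with matrix `g * [M; 1_d]`; its range is the column span of
that matrix. -/
noncomputable def graphMap {c d : ℕ} (g : GL (Fin c ⊕ Fin d) ℂ) (M : Matrix (Fin c) (Fin d) ℂ) :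
    (Fin d → ℂ) →ₗ[ℂ] (Fin c ⊕ Fin d → ℂ) :=
  g.val.mulVecLin ∘ₗ (Matrix.fromRows M (1 : Matrix (Fin d) (Fin d) ℂ)).mulVecLin

/-- The column span of `g * [M; 1_d]` is `d`-dimensional. -/
theorem finrank_range_graphMap {c d : ℕ} (g : GL (Fin c ⊕ Fin d) ℂ)
    (M : Matrix (Fin c) (Fin d) ℂ) :
    Module.finrank ℂ (LinearMap.range (graphMap g M)) = d := by
  have hinj : Function.Injective (graphMap g M) := by
    intro v w h
    have hg : ∀ x, (g⁻¹).val.mulVec (g.val.mulVec x) = x := fun x => by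
      rw [Matrix.mulVec_mulVec, Units.inv_mul, Matrix.one_mulVec]
    have h2 : (Matrix.fromRows M (1 : Matrix (Fin d) (Fin d) ℂ)).mulVec v
        = (Matrix.fromRows M (1 : Matrix (Fin d) (Fin d) ℂ)).mulVec w := by
      have h3 : (g⁻¹).val.mulVec (g.val.mulVec _) = (g⁻¹).val.mulVec (g.val.mulVec _) :=
        congrArg (g⁻¹).val.mulVec h
      rwa [hg, hg] at h3
    rw [Matrix.fromRows_mulVec, Matrix.fromRows_mulVec] at h2
    funext i
    simpa using congrFun h2 (Sum.inr i)
  rw [LinearMap.finrank_range_of_inj hinj]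
  simp

/-- The inverse `M ↦ g [M; 1_d]` of the standard chart of the Grassmannian translated by `g`:
the matrix `M` is sent to the span of the columns of `g * [M; 1_d]`. The inverses of these maps,
for `g` in `GL(c+d,ℂ)`, form a holomorphic atlas. -/
noncomputable def Grassmannian.param {c d : ℕ} (g : GL (Fin c ⊕ Fin d) ℂ)
    (M : Matrix (Fin c) (Fin d) ℂ) : Grassmannian c d :=
  ⟨LinearMap.range (graphMap g M), finrank_range_graphMap g M⟩

/-- The charts cover the Grassmannian. -/
theorem Grassmannian.exists_mem_range_param {c d : ℕ} (V : Grassmannian c d) :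
    ∃ g : GL (Fin c ⊕ Fin d) ℂ, V ∈ Set.range (Grassmannian.param g) := by
  obtain ⟨V, hV⟩ := V
  obtain ⟨Q, hQ⟩ := Submodule.exists_isCompl V
  have hQd : Module.finrank ℂ Q = c := by
    have h := Submodule.finrank_add_eq_of_isCompl hQ
    simp at h
    omega
  have e₁ : (Fin c → ℂ) ≃ₗ[ℂ] Q := LinearEquiv.ofFinrankEq _ _ (by simp [hQd])
  have e₂ : (Fin d → ℂ) ≃ₗ[ℂ] V := LinearEquiv.ofFinrankEq _ _ (by simp [hV])
  let e : (Fin c ⊕ Fin d → ℂ) ≃ₗ[ℂ] (Fin c ⊕ Fin d → ℂ) :=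
    (LinearEquiv.sumArrowLequivProdArrow (Fin c) (Fin d) ℂ ℂ).trans
      ((e₁.prodCongr e₂).trans (Submodule.prodEquivOfIsCompl Q V hQ.symm))
  have he : ∀ w : Fin d → ℂ, e (Sum.elim 0 w) = (e₂ w : Fin c ⊕ Fin d → ℂ) := by
    intro w
    have h0 : (LinearEquiv.sumArrowLequivProdArrow (Fin c) (Fin d) ℂ ℂ) (Sum.elim 0 w)
        = (0, w) := by
      ext <;> rfl
    simp only [e, LinearEquiv.trans_apply, h0]
    simp
  have hA : LinearMap.toMatrix' e.toLinearMap * LinearMap.toMatrix' e.symm.toLinearMap = 1 := by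
    rw [← LinearMap.toMatrix'_comp]; simp
  have hB : LinearMap.toMatrix' e.symm.toLinearMap * LinearMap.toMatrix' e.toLinearMap = 1 := by
    rw [← LinearMap.toMatrix'_comp]; simp
  let g : GL (Fin c ⊕ Fin d) ℂ := ⟨_, _, hA, hB⟩
  refine ⟨g, 0, Subtype.ext ?_⟩
  have key : ∀ w : Fin d → ℂ, graphMap g 0 w = (e₂ w : Fin c ⊕ Fin d → ℂ) := by
    intro w
    rw [graphMap, LinearMap.comp_apply, Matrix.mulVecLin_apply, Matrix.mulVecLin_apply,
      LinearMap.toMatrix'_mulVec, Matrix.fromRows_mulVec, Matrix.zero_mulVec, Matrix.one_mulVec]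
    exact he w
  apply le_antisymm
  · rintro _ ⟨w, rfl⟩
    exact (key w).symm ▸ (e₂ w).2
  · intro v hv
    exact ⟨e₂.symm ⟨v, hv⟩, by rw [key]; simp⟩

/-- `W` is holomorphic on the open set `U`: in every chart of the above atlas around `W z₀`, with
`z₀ ∈ U`, the map `W` is, near `z₀`, given by a matrix that is complex differentiable at `z₀`. -/
def Grassmannian.HolomorphicOn {c d : ℕ} (W : ℂ → Grassmannian c d) (U : Set ℂ) : Prop :=
  ∀ z₀ ∈ U, ∀ g : GL (Fin c ⊕ Fin d) ℂ, W z₀ ∈ Set.range (Grassmannian.param g) →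
    ∃ M : ℂ → Matrix (Fin c) (Fin d) ℂ,
      (∀ᶠ z in 𝓝 z₀, W z = Grassmannian.param g (M z)) ∧
      ∀ i j, DifferentiableAt ℂ (fun z => M z i j) z₀

/-! Let Q be the Hermitian form of signature (c,d). The matrices T_j preserve Q, and for |z| < 1 the
factor B(z) shrinks the positive part of Q below a rate at which it does not shrink the negative
part. Hence Q(D(z)v) < s² Q(v) for all v ≠ 0, with some s > 0: Q is a strict Lyapunov function for
s⁻¹D(z). It follows that no eigenvalue has modulus s, that Q ≥ 0 on the sum of the generalized
eigenspaces with |μ| < s, and that Q < 0 off 0 on the sum W(z) of those with |μ| > s. Counting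
dimensions against the signature gives dim W(z) = d, and W(z) is the graph of a matrix K(z)
(`finrank_unstableSubspace`, `exists_unstableSubspace_eq_range_graphMap`).

For holomorphy, push the negative coordinate subspace forward by D(z)^k. Its image is the graph of a
matrix that is rational in the entries of D(z)^k, has entries bounded by 1, and converges to K(z)
(`tendsto_graphMatrix_pow`). A bounded pointwise limit of holomorphic functions is holomorphic.

Triangular bases of W(z) and of its complement express every eigenvalue of Λ^d D(z) as a product of
d eigenvalues of D(z). The largest modulus is |det D_W(z)| (`exteriorSpectralRadius_eq_norm_det`).
This determinant is holomorphic and nonvanishing, so the log of its modulus is harmonic. Continuity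
up to the circle needs no W: the spectral radius depends continuously on a matrix, and D(z) is
invertible for z ≠ 0. -/

section Form

/-! ### The indefinite form and its strict decrease under D(z). -/

open Matrix

variable {c d : ℕ}

/-- The Hermitian form of signature `(c,d)`, as a real quadratic form. -/
noncomputable def signatureForm {c d : ℕ} (v : Fin c ⊕ Fin d → ℂ) : ℝ :=
  ∑ i, ‖v (Sum.inl i)‖ ^ 2 - ∑ j, ‖v (Sum.inr j)‖ ^ 2

theorem signatureForm_smul (a : ℂ) (v : Fin c ⊕ Fin d → ℂ) :
    signatureForm (a • v) = ‖a‖ ^ 2 * signatureForm v := by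
  simp only [signatureForm, Pi.smul_apply, smul_eq_mul, norm_mul, mul_pow, ← Finset.mul_sum]
  ring

theorem continuous_signatureForm :
    Continuous (signatureForm : (Fin c ⊕ Fin d → ℂ) → ℝ) := by
  unfold signatureForm
  fun_prop

theorem coe_signatureForm (v : Fin c ⊕ Fin d → ℂ) :
    (signatureForm v : ℂ) = star v ⬝ᵥ (signatureMatrix c d *ᵥ v) := by
  have h : ∀ w : ℂ, ((‖w‖ : ℂ)) ^ 2 = star w * w := fun w => by
    rw [Complex.star_def, Complex.conj_mul']
  simp only [signatureForm, signatureMatrix, Matrix.fromBlocks_mulVec, dotProduct,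
    Fintype.sum_sum_type]
  push_cast
  simp [h, sub_eq_add_neg, Matrix.neg_mulVec]

theorem signatureForm_mulVec_of_mem_pseudoUnitary
    {T : Matrix (Fin c ⊕ Fin d) (Fin c ⊕ Fin d) ℂ} (hT : T ∈ pseudoUnitary c d)
    (v : Fin c ⊕ Fin d → ℂ) : signatureForm (T *ᵥ v) = signatureForm v := by
  have hT' : Tᴴ * signatureMatrix c d * T = signatureMatrix c d := hT
  apply Complex.ofReal_injective
  rw [coe_signatureForm, coe_signatureForm, Matrix.star_mulVec, ← Matrix.dotProduct_mulVec,
    Matrix.mulVec_mulVec, Matrix.mulVec_mulVec, hT']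

theorem isUnit_of_mem_pseudoUnitary
    {T : Matrix (Fin c ⊕ Fin d) (Fin c ⊕ Fin d) ℂ} (hT : T ∈ pseudoUnitary c d) : IsUnit T := by
  have hT' : Tᴴ * signatureMatrix c d * T = signatureMatrix c d := hT
  have hG : signatureMatrix c d * signatureMatrix c d = 1 := by
    simp [signatureMatrix, Matrix.fromBlocks_multiply]
  have h : (signatureMatrix c d * Tᴴ * signatureMatrix c d) * T = 1 := by
    rw [mul_assoc, mul_assoc, ← mul_assoc Tᴴ, hT', hG]
  exact IsUnit.of_mul_eq_one_right _ h

theorem isUnit_scalingMatrix {z : ℂ} (hz : z ≠ 0) : IsUnit (scalingMatrix c d z) := by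
  refine IsUnit.of_mul_eq_one (scalingMatrix c d z⁻¹) ?_
  simp [scalingMatrix, Matrix.fromBlocks_multiply, hz]

theorem isUnit_cocycleMatrix {n : ℕ} {T : Fin n → Matrix (Fin c ⊕ Fin d) (Fin c ⊕ Fin d) ℂ}
    (hT : ∀ j, T j ∈ pseudoUnitary c d) {z : ℂ} (hz : z ≠ 0) : IsUnit (cocycleMatrix T z) := by
  refine List.prod_isUnit fun A hA => ?_
  obtain ⟨j, rfl⟩ := (List.mem_ofFn' _ _).1 hA
  exact (isUnit_scalingMatrix hz).mul (isUnit_of_mem_pseudoUnitary (hT j))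

theorem signatureForm_scalingMatrix_mulVec (z : ℂ) (w : Fin c ⊕ Fin d → ℂ) :
    signatureForm (scalingMatrix c d z *ᵥ w) =
      ‖z‖ ^ 2 * ∑ i, ‖w (Sum.inl i)‖ ^ 2 - ∑ j, ‖w (Sum.inr j)‖ ^ 2 := by
  simp [signatureForm, scalingMatrix, Matrix.fromBlocks_mulVec, Matrix.smul_mulVec, mul_pow,
    Finset.mul_sum]

theorem sum_norm_sq_add_sum_norm_sq_pos {w : Fin c ⊕ Fin d → ℂ} (hw : w ≠ 0) :
    0 < ∑ i, ‖w (Sum.inl i)‖ ^ 2 ∨ 0 < ∑ j, ‖w (Sum.inr j)‖ ^ 2 := by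
  obtain ⟨i | j, h⟩ := Function.ne_iff.1 hw
  · exact Or.inl (Finset.sum_pos' (fun _ _ => by positivity)
      ⟨i, Finset.mem_univ _, by have := norm_pos_iff.2 h; positivity⟩)
  · exact Or.inr (Finset.sum_pos' (fun _ _ => by positivity)
      ⟨j, Finset.mem_univ _, by have := norm_pos_iff.2 h; positivity⟩)

/-- Any t strictly between |z|² and 1 works: the positive part is multiplied by |z|² < t, the
negative part by 1 > t, and one of the two parts is nonzero. -/
theorem signatureForm_scalingMatrix_mulVec_lt {z : ℂ} {t : ℝ} (ht : ‖z‖ ^ 2 < t) (ht1 : t < 1)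
    {w : Fin c ⊕ Fin d → ℂ} (hw : w ≠ 0) :
    signatureForm (scalingMatrix c d z *ᵥ w) < t * signatureForm w := by
  rw [signatureForm_scalingMatrix_mulVec, signatureForm]
  have h1 : 0 ≤ ∑ i, ‖w (Sum.inl i)‖ ^ 2 := by positivity
  have h2 : 0 ≤ ∑ j, ‖w (Sum.inr j)‖ ^ 2 := by positivity
  rcases sum_norm_sq_add_sum_norm_sq_pos hw with h | h
  · nlinarith [mul_pos (sub_pos.2 ht) h, mul_nonneg (sub_pos.2 ht1).le h2]
  · nlinarith [mul_nonneg (sub_pos.2 ht).le h1, mul_pos (sub_pos.2 ht1) h]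

theorem signatureForm_prod_mulVec_lt {t : ℝ} (ht : 0 < t)
    (l : List (Matrix (Fin c ⊕ Fin d) (Fin c ⊕ Fin d) ℂ)) (hl : l ≠ [])
    (h : ∀ A ∈ l, ∀ v ≠ 0, signatureForm (A *ᵥ v) < t * signatureForm v)
    {v : Fin c ⊕ Fin d → ℂ} (hv : v ≠ 0) :
    signatureForm (l.prod *ᵥ v) < t ^ l.length * signatureForm v := by
  induction l with
  | nil => exact absurd rfl hl
  | cons A l ih =>
    have hA := h A List.mem_cons_self
    by_cases hl' : l = []
    · subst hl'
      simpa using hA v hv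
    have ih' := ih hl' fun B hB => h B (List.mem_cons_of_mem _ hB)
    rw [List.prod_cons, List.length_cons, ← Matrix.mulVec_mulVec, pow_succ']
    have hle : signatureForm (A *ᵥ (l.prod *ᵥ v)) ≤ t * signatureForm (l.prod *ᵥ v) := by
      by_cases h0 : l.prod *ᵥ v = 0
      · simp [h0, signatureForm]
      · exact (hA _ h0).le
    calc _ ≤ t * signatureForm (l.prod *ᵥ v) := hle
      _ < t * (t ^ l.length * signatureForm v) := by gcongr
      _ = _ := by ring

/-- The rate `s` with `|z|^n < s < 1` which separates the eigenvalues of `D(z)`. -/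
noncomputable def separatingRate (n : ℕ) (z : ℂ) : ℝ := √((‖z‖ ^ 2 + 1) / 2) ^ n

theorem separatingRate_pos (n : ℕ) (z : ℂ) : 0 < separatingRate n z := by
  unfold separatingRate
  positivity

theorem signatureForm_cocycleEnd_lt {n : ℕ} (hn : 0 < n)
    {T : Fin n → Matrix (Fin c ⊕ Fin d) (Fin c ⊕ Fin d) ℂ}
    (hT : ∀ j, T j ∈ pseudoUnitary c d) {z : ℂ} (hz : ‖z‖ < 1)
    {v : Fin c ⊕ Fin d → ℂ} (hv : v ≠ 0) :
    signatureForm (cocycleEnd T z v) < separatingRate n z ^ 2 * signatureForm v := by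
  have hz2 : ‖z‖ ^ 2 < 1 := by nlinarith [norm_nonneg z]
  have hs : separatingRate n z ^ 2 = ((‖z‖ ^ 2 + 1) / 2) ^ n := by
    rw [separatingRate, ← pow_mul, mul_comm, pow_mul, Real.sq_sqrt (by positivity)]
  -- The rate per factor is the midpoint of |z|² and 1, and n > 0 makes the product nonempty, so
  -- that strictness survives.
  have := signatureForm_prod_mulVec_lt (t := (‖z‖ ^ 2 + 1) / 2) (by positivity)
    (List.ofFn fun j => scalingMatrix c d z * T j)
    (fun h => hn.ne' (by simpa using h)) (fun A hA w hw => ?_) hv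
  · simpa [hs, cocycleEnd, cocycleMatrix] using this
  · obtain ⟨j, rfl⟩ := (List.mem_ofFn' _ _).1 hA
    have hTw : T j *ᵥ w ≠ 0 := fun h0 => hw (Matrix.mulVec_injective_of_isUnit
      (isUnit_of_mem_pseudoUnitary (hT j)) (by simpa using h0))
    have := signatureForm_scalingMatrix_mulVec_lt (z := z) (t := (‖z‖ ^ 2 + 1) / 2)
      (by linarith) (by linarith) hTw
    rwa [signatureForm_mulVec_of_mem_pseudoUnitary (hT j), Matrix.mulVec_mulVec] at this

end Form

/-! ### Spectral splitting by a strict Lyapunov form. -/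

section Dichotomy

open Filter

theorem tendsto_zero_of_norm_contraction {E : Type*} [NormedAddCommGroup E] [NormedSpace ℂ E]
    {a : ℂ} (ha : ‖a‖ < 1) {x e : ℕ → E} (hx : ∀ k, x (k + 1) = a • x k + e k)
    (he : Tendsto e atTop (𝓝 0)) : Tendsto x atTop (𝓝 0) := by
  rw [Metric.tendsto_atTop]
  intro ε hε
  -- With forcing at most ε/2 · (1 - ‖a‖), the value ε/2 is a fixed point of the recursive bound.
  have ha' : 0 < ε / 2 * (1 - ‖a‖) := mul_pos (by linarith) (by linarith)
  obtain ⟨K, hK⟩ := (Metric.tendsto_atTop.1 he) _ ha'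
  have hstep : ∀ m, ‖x (K + m)‖ ≤ ε / 2 + ‖a‖ ^ m * ‖x K‖ := by
    intro m
    induction m with
    | zero => simpa using (half_pos hε).le
    | succ m ih =>
      have h1 : ‖e (K + m)‖ < ε / 2 * (1 - ‖a‖) := by simpa using hK (K + m) (by omega)
      have h2 : ‖x (K + (m + 1))‖ ≤ ‖a‖ * ‖x (K + m)‖ + ‖e (K + m)‖ := by
        rw [← add_assoc, hx, ← norm_smul]
        exact norm_add_le _ _
      calc _ ≤ ‖a‖ * (ε / 2 + ‖a‖ ^ m * ‖x K‖) + ε / 2 * (1 - ‖a‖) := by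
              refine h2.trans (add_le_add ?_ h1.le)
              gcongr
        _ = _ := by ring
  have hlim : Tendsto (fun m => ‖a‖ ^ m * ‖x K‖) atTop (𝓝 0) := by
    simpa using (tendsto_pow_atTop_nhds_zero_of_lt_one (norm_nonneg a) ha).mul_const ‖x K‖
  obtain ⟨M, hM⟩ := (Metric.tendsto_atTop.1 hlim) (ε / 2) (by linarith)
  refine ⟨K + M, fun n hn => ?_⟩
  obtain ⟨m, rfl⟩ := Nat.exists_eq_add_of_le (show K ≤ n by omega)
  have h3 := hM m (by omega)
  rw [Real.dist_eq, sub_zero] at h3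
  have h4 := (le_abs_self _).trans_lt h3
  rw [dist_zero_right]
  linarith [hstep m]

variable {V : Type*} [NormedAddCommGroup V] [NormedSpace ℂ V]

/-- Induction on the nilpotency order: f v = μ v + (f - μ)v makes the rescaled orbit of v a
contraction by μ/s, forced by the orbit of (f - μ)v, which tends to 0 by induction. -/
theorem tendsto_iterate_of_mem_maxGenEigenspace (f : Module.End ℂ V) {s : ℝ} (hs : 0 < s) {μ : ℂ}
    (hμ : ‖μ‖ < s) {v : V} (hv : v ∈ f.maxGenEigenspace μ) :
    Tendsto (fun k : ℕ => ((s : ℂ) ^ k)⁻¹ • (f ^ k) v) atTop (𝓝 0) := by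
  obtain ⟨m, hm⟩ := (Module.End.mem_maxGenEigenspace f μ v).1 hv
  clear hv
  have hs' : (s : ℂ) ≠ 0 := by exact_mod_cast hs.ne'
  induction m generalizing v with
  | zero =>
    have : v = 0 := by simpa using hm
    simp [this]
  | succ m ih =>
    have hu := ih (v := (f - μ • 1) v) (by rwa [pow_succ, Module.End.mul_apply] at hm)
    refine tendsto_zero_of_norm_contraction (a := (s : ℂ)⁻¹ * μ)
      (e := fun k => (s : ℂ)⁻¹ • ((s : ℂ) ^ k)⁻¹ • (f ^ k) ((f - μ • 1) v)) ?_ (fun k => ?_) ?_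
    · rw [norm_mul, norm_inv, Complex.norm_real, Real.norm_of_nonneg hs.le, inv_mul_lt_iff₀ hs]
      simpa using hμ
    · rw [pow_succ f, pow_succ, Module.End.mul_apply]
      have : f v = μ • v + (f - μ • 1) v := by simp
      rw [this, map_add, map_smul]
      simp only [mul_inv, smul_add, smul_smul]
      congr 2 <;> ring
    · simpa using hu.const_smul (s : ℂ)⁻¹

/-- `u` is a backward orbit of `s⁻¹ f` which converges to `0`. -/
def IsBackwardOrbit (f : Module.End ℂ V) (s : ℝ) (u : ℕ → V) : Prop :=
  (∀ k, f (u (k + 1)) = (s : ℂ) • u k) ∧ Tendsto u atTop (𝓝 0)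

/-- Since f may be singular, backward orbits replace powers of f⁻¹. Given such an orbit e of (f -
μ)v, solving μ u(k+1) + e(k+1) = s u(k) gives a contraction by s/μ with vanishing forcing. -/
theorem exists_isBackwardOrbit_of_mem_maxGenEigenspace (f : Module.End ℂ V) {s : ℝ} (hs : 0 < s)
    {μ : ℂ} (hμ : s < ‖μ‖) {v : V} (hv : v ∈ f.maxGenEigenspace μ) :
    ∃ u : ℕ → V, u 0 = v ∧ IsBackwardOrbit f s u := by
  obtain ⟨m, hm⟩ := (Module.End.mem_maxGenEigenspace f μ v).1 hv
  clear hv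
  have hμ0 : μ ≠ 0 := norm_pos_iff.1 (hs.trans hμ)
  induction m generalizing v with
  | zero =>
    have : v = 0 := by simpa using hm
    exact ⟨0, this.symm, by simp, tendsto_const_nhds⟩
  | succ m ih =>
    obtain ⟨e, he0, he, hlim⟩ := ih (v := (f - μ • 1) v)
      (by rwa [pow_succ, Module.End.mul_apply] at hm)
    let u : ℕ → V := fun k => Nat.rec v (fun k w => μ⁻¹ • ((s : ℂ) • w - e (k + 1))) k
    have hu : ∀ k, u (k + 1) = μ⁻¹ • ((s : ℂ) • u k - e (k + 1)) := fun k => rfl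
    have hfu : ∀ k, f (u k) = μ • u k + e k := by
      intro k
      induction k with
      | zero =>
        rw [he0]
        simp [u]
      | succ k ihk =>
        rw [hu, map_smul, map_sub, map_smul, ihk, he, smul_inv_smul₀ hμ0]
        simp only [smul_add, smul_sub, smul_smul]
        rw [show μ⁻¹ * ((s : ℂ) * μ) = s by field_simp]
        abel
    refine ⟨u, rfl, fun k => ?_, ?_⟩
    · calc f (u (k + 1)) = μ • u (k + 1) + e (k + 1) := hfu (k + 1)
        _ = _ := by rw [hu, smul_inv_smul₀ hμ0, sub_add_cancel]
    · refine tendsto_zero_of_norm_contraction (a := μ⁻¹ * s)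
        (e := fun k => -(μ⁻¹ • e (k + 1))) ?_ (fun k => ?_) ?_
      · rw [norm_mul, norm_inv, Complex.norm_real, Real.norm_of_nonneg hs.le,
          inv_mul_lt_iff₀ (hs.trans hμ)]
        simpa using hμ
      · rw [hu, smul_sub, smul_smul, sub_eq_add_neg]
      · simpa using ((hlim.comp (tendsto_add_atTop_nat 1)).const_smul μ⁻¹).neg

/-- The sum of the generalized eigenspaces for the eigenvalues of absolute value less than `s`. -/
def stableSubspace (f : Module.End ℂ V) (s : ℝ) : Submodule ℂ V :=
  ⨆ μ ∈ {μ : ℂ | ‖μ‖ < s}, f.maxGenEigenspace μ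

/-- The sum of the generalized eigenspaces for the eigenvalues of absolute value more than `s`. -/
def unstableSubspace (f : Module.End ℂ V) (s : ℝ) : Submodule ℂ V :=
  ⨆ μ ∈ {μ : ℂ | s < ‖μ‖}, f.maxGenEigenspace μ

theorem map_mem_biSup_maxGenEigenspace (f : Module.End ℂ V) (S : Set ℂ) {v : V}
    (hv : v ∈ ⨆ μ ∈ S, f.maxGenEigenspace μ) : f v ∈ ⨆ μ ∈ S, f.maxGenEigenspace μ := by
  have h : (⨆ μ ∈ S, f.maxGenEigenspace μ) ≤ (⨆ μ ∈ S, f.maxGenEigenspace μ).comap f := by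
    refine iSup₂_le fun μ hμ w hw => ?_
    exact Submodule.mem_iSup_of_mem μ (Submodule.mem_iSup_of_mem hμ
      (Module.End.mapsTo_maxGenEigenspace_of_comm (Commute.refl f) μ hw))
  exact h hv

theorem tendsto_iterate_of_mem_stableSubspace (f : Module.End ℂ V) {s : ℝ} (hs : 0 < s) {v : V}
    (hv : v ∈ stableSubspace f s) :
    Tendsto (fun k : ℕ => ((s : ℂ) ^ k)⁻¹ • (f ^ k) v) atTop (𝓝 0) := by
  let P : Submodule ℂ V :=
    { carrier := {v | Tendsto (fun k : ℕ => ((s : ℂ) ^ k)⁻¹ • (f ^ k) v) atTop (𝓝 0)}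
      add_mem' := fun {a b} ha hb => by simpa using Tendsto.add ha hb
      zero_mem' := by simp
      smul_mem' := fun a v hv => by simpa [smul_comm a] using Tendsto.const_smul hv a }
  have h : stableSubspace f s ≤ P := iSup₂_le fun μ hμ w hw =>
    tendsto_iterate_of_mem_maxGenEigenspace f hs hμ hw
  exact h hv

theorem exists_isBackwardOrbit_of_mem_unstableSubspace (f : Module.End ℂ V) {s : ℝ} (hs : 0 < s)
    {v : V} (hv : v ∈ unstableSubspace f s) : ∃ u : ℕ → V, u 0 = v ∧ IsBackwardOrbit f s u := by
  let P : Submodule ℂ V :=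
    { carrier := {v | ∃ u : ℕ → V, u 0 = v ∧ IsBackwardOrbit f s u}
      add_mem' := by
        rintro _ _ ⟨u, rfl, hu⟩ ⟨w, rfl, hw⟩
        exact ⟨fun k => u k + w k, rfl, fun k => by simp [hu.1, hw.1], by simpa using hu.2.add hw.2⟩
      zero_mem' := ⟨0, rfl, by simp, tendsto_const_nhds⟩
      smul_mem' := by
        rintro a _ ⟨u, rfl, hu⟩
        exact ⟨fun k => a • u k, rfl, fun k => by simp [hu.1, smul_comm a],
          by simpa using hu.2.const_smul a⟩ }
  have h : unstableSubspace f s ≤ P := iSup₂_le fun μ hμ w hw =>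
    exists_isBackwardOrbit_of_mem_maxGenEigenspace f hs hμ hw
  exact h hv

/-- `Q` is a continuous quadratic form for which `s⁻¹ f` is strictly decreasing. -/
structure IsStrictLyapunov (f : Module.End ℂ V) (s : ℝ) (Q : V → ℝ) : Prop where
  pos : 0 < s
  continuous : Continuous Q
  smul : ∀ (a : ℂ) (v : V), Q (a • v) = ‖a‖ ^ 2 * Q v
  lt : ∀ v ≠ 0, Q (f v) < s ^ 2 * Q v

namespace IsStrictLyapunov

variable {f : Module.End ℂ V} {s : ℝ} {Q : V → ℝ}

theorem map_zero (h : IsStrictLyapunov f s Q) : Q 0 = 0 := by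
  simpa using h.smul 0 0

theorem le (h : IsStrictLyapunov f s Q) (v : V) : Q (f v) ≤ s ^ 2 * Q v := by
  by_cases hv : v = 0
  · simp [hv, h.map_zero]
  · exact (h.lt v hv).le

theorem pow_le (h : IsStrictLyapunov f s Q) (v : V) (k : ℕ) :
    Q ((f ^ k) v) ≤ (s ^ k) ^ 2 * Q v := by
  induction k with
  | zero => simp
  | succ k ih =>
    rw [pow_succ', Module.End.mul_apply]
    have hs : 0 ≤ s ^ 2 := by positivity
    calc _ ≤ s ^ 2 * Q ((f ^ k) v) := h.le _
      _ ≤ s ^ 2 * ((s ^ k) ^ 2 * Q v) := by gcongr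
      _ = _ := by ring

/-- Q of the rescaled forward orbit never exceeds Q v, while it tends to Q 0 = 0. -/
theorem nonneg_of_tendsto (h : IsStrictLyapunov f s Q) {v : V}
    (hv : Tendsto (fun k : ℕ => ((s : ℂ) ^ k)⁻¹ • (f ^ k) v) atTop (𝓝 0)) : 0 ≤ Q v := by
  have h1 := (h.continuous.tendsto 0).comp hv
  rw [h.map_zero] at h1
  refine le_of_tendsto h1 (Eventually.of_forall fun k => ?_)
  have hk : 0 < s ^ k := pow_pos h.pos k
  simp only [Function.comp_apply]
  rw [h.smul, norm_inv, norm_pow, Complex.norm_real, Real.norm_of_nonneg h.pos.le, inv_pow,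
    inv_mul_le_iff₀ (by positivity)]
  exact h.pow_le v k

theorem nonneg_of_mem_stableSubspace (h : IsStrictLyapunov f s Q) {v : V}
    (hv : v ∈ stableSubspace f s) : 0 ≤ Q v :=
  h.nonneg_of_tendsto (tendsto_iterate_of_mem_stableSubspace f h.pos hv)

/-- Along a backward orbit Q is nondecreasing, with limit Q 0 = 0. -/
theorem nonpos_of_isBackwardOrbit (h : IsStrictLyapunov f s Q) {u : ℕ → V}
    (hu : IsBackwardOrbit f s u) : Q (u 0) ≤ 0 := by
  have h1 := (h.continuous.tendsto 0).comp hu.2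
  rw [h.map_zero] at h1
  have hmono : Monotone (Q ∘ u) := by
    refine monotone_nat_of_le_succ fun k => ?_
    have := h.le (u (k + 1))
    rw [hu.1, h.smul, Complex.norm_real, Real.norm_of_nonneg h.pos.le] at this
    exact le_of_mul_le_mul_left this (pow_pos h.pos 2)
  exact hmono.ge_of_tendsto h1 0

theorem neg_of_mem_unstableSubspace (h : IsStrictLyapunov f s Q) {v : V}
    (hv : v ∈ unstableSubspace f s) (hv0 : v ≠ 0) : Q v < 0 := by
  obtain ⟨u, rfl, hu⟩ := exists_isBackwardOrbit_of_mem_unstableSubspace f h.pos hv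
  have hs : (s : ℂ) ≠ 0 := by exact_mod_cast h.pos.ne'
  have hu1 : u 1 ≠ 0 := by
    intro h1
    have := hu.1 0
    rw [zero_add, h1, _root_.map_zero] at this
    exact hv0 ((smul_eq_zero.1 this.symm).resolve_left hs)
  -- Strictness: the shifted orbit gives Q(u 1) ≤ 0, and the single step from u 1 to u 0 decreases Q
  -- strictly.
  have h1 : Q (u 1) ≤ 0 := h.nonpos_of_isBackwardOrbit (u := fun k => u (k + 1))
    ⟨fun k => hu.1 (k + 1), hu.2.comp (tendsto_add_atTop_nat 1)⟩
  have h2 := h.lt _ hu1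
  rw [show f (u 1) = (s : ℂ) • u 0 from hu.1 0, h.smul, Complex.norm_real,
    Real.norm_of_nonneg h.pos.le] at h2
  exact (lt_of_mul_lt_mul_left h2 (by positivity)).trans_le h1

theorem disjoint (h : IsStrictLyapunov f s Q) :
    Disjoint (stableSubspace f s) (unstableSubspace f s) := by
  rw [Submodule.disjoint_def]
  intro v h1 h2
  by_contra hv
  exact absurd (h.neg_of_mem_unstableSubspace h2 hv) (h.nonneg_of_mem_stableSubspace h1).not_gt

theorem norm_ne_of_hasEigenvalue (h : IsStrictLyapunov f s Q) {μ : ℂ} (hμ : f.HasEigenvalue μ) :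
    ‖μ‖ ≠ s := by
  rintro rfl
  obtain ⟨v, hv⟩ := hμ.exists_hasEigenvector
  have := h.lt v hv.2
  rw [hv.apply_eq_smul, h.smul] at this
  exact lt_irrefl _ this

theorem isCompl [FiniteDimensional ℂ V] (h : IsStrictLyapunov f s Q) :
    IsCompl (stableSubspace f s) (unstableSubspace f s) := by
  refine ⟨h.disjoint, codisjoint_iff_le_sup.2 ?_⟩
  rw [← Module.End.iSup_maxGenEigenspace_eq_top f]
  refine iSup_le fun μ => ?_
  rcases lt_trichotomy ‖μ‖ s with hμ | hμ | hμ
  · exact le_sup_of_le_left (le_iSup₂_of_le μ hμ le_rfl)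
  · have : f.maxGenEigenspace μ = ⊥ := by
      by_contra hne
      refine h.norm_ne_of_hasEigenvalue (Module.End.hasEigenvalue_iff.2 fun he => hne ?_) hμ
      rw [eq_bot_iff]
      intro v hv
      obtain ⟨m, hm⟩ := (Module.End.mem_maxGenEigenspace f μ v).1 hv
      have hinj : Function.Injective ((f - μ • 1 : Module.End ℂ V) ^ m) := by
        rw [Module.End.coe_pow]
        refine Function.Injective.iterate (LinearMap.ker_eq_bot.1 ?_) m
        rwa [Module.End.eigenspace_def] at he
      exact (Submodule.mem_bot ℂ).2 (hinj (by rw [hm, _root_.map_zero]))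
    rw [this]
    exact bot_le
  · exact le_sup_of_le_right (le_iSup₂_of_le μ hμ le_rfl)

end IsStrictLyapunov

end Dichotomy

/-! ### Bounded limits of holomorphic functions. -/

section BoundedLimit

open Filter MeasureTheory

/-- A bounded pointwise limit of holomorphic functions on an open set is holomorphic. -/
theorem differentiableOn_of_tendsto_of_norm_le {U : Set ℂ} (hU : IsOpen U) {F : ℕ → ℂ → ℂ}
    {f : ℂ → ℂ} {C : ℝ} (hF : ∀ n, DifferentiableOn ℂ (F n) U) (hC : ∀ n, ∀ z ∈ U, ‖F n z‖ ≤ C)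
    (hf : ∀ z ∈ U, Tendsto (fun n => F n z) atTop (𝓝 (f z))) : DifferentiableOn ℂ f U := by
  intro a ha
  refine DifferentiableAt.differentiableWithinAt ?_
  obtain ⟨ε, hε, hball⟩ := Metric.isOpen_iff.1 hU a ha
  obtain ⟨R, hR, hsub⟩ : ∃ R : NNReal, 0 < R ∧ Metric.closedBall a R ⊆ U :=
    ⟨⟨ε / 2, (half_pos hε).le⟩, half_pos hε,
      (Metric.closedBall_subset_ball (half_lt_self hε)).trans hball⟩
  have hcircle : ∀ θ, circleMap a R θ ∈ U := fun θ =>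
    hsub (Metric.sphere_subset_closedBall (circleMap_mem_sphere a R.coe_nonneg θ))
  have hcont : ∀ n, Continuous fun θ => F n (circleMap a R θ) := fun n =>
    (hF n).continuousOn.comp_continuous (continuous_circleMap a R) hcircle
  have hmeas : AEStronglyMeasurable (fun θ => f (circleMap a R θ)) volume :=
    aestronglyMeasurable_of_tendsto_ae atTop (fun n => (hcont n).aestronglyMeasurable)
      (ae_of_all _ fun θ => hf _ (hcircle θ))
  have hfC : ∀ z ∈ U, ‖f z‖ ≤ C := fun z hz =>
    le_of_tendsto (hf z hz).norm (Eventually.of_forall fun n => hC n z hz)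
  have hint : CircleIntegrable f a R :=
    (intervalIntegrable_const (c := C)).mono_fun hmeas.restrict
      (ae_of_all _ fun θ => (hfC _ (hcircle θ)).trans (le_abs_self C))
  -- The Cauchy integral of f is analytic whatever f is on the circle. It equals f inside by
  -- dominated convergence in the Cauchy formulas of the F n.
  have hseries := hasFPowerSeriesOn_cauchy_integral hint hR
  refine (hseries.analyticAt.differentiableAt).congr_of_eventuallyEq ?_
  filter_upwards [Metric.ball_mem_nhds a (show 0 < (R : ℝ) from hR)] with w hw
  have hcauchy : ∀ n, F n w =
      (2 * Real.pi * Complex.I : ℂ)⁻¹ • ∮ z in C(a, R), (z - w)⁻¹ • F n z := by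
    intro n
    have hd : DiffContOnCl ℂ (F n) (Metric.ball a R) :=
      ((hF n).mono (closure_minimal Metric.ball_subset_closedBall Metric.isClosed_closedBall
        |>.trans hsub)).diffContOnCl
    rw [hd.circleIntegral_sub_inv_smul hw, inv_smul_smul₀ Complex.two_pi_I_ne_zero]
  have hden : ∀ θ, circleMap a R θ - w ≠ 0 := fun θ h0 => by
    have h1 := circleMap_mem_sphere a R.coe_nonneg θ
    rw [sub_eq_zero.1 h0] at h1
    exact (Metric.mem_ball.1 hw).ne (Metric.mem_sphere.1 h1)
  have hker : Continuous fun θ => deriv (circleMap a R) θ * (circleMap a R θ - w)⁻¹ := by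
    simp only [deriv_circleMap]
    have := continuous_circleMap a (R : ℝ)
    have := continuous_circleMap 0 (R : ℝ)
    exact Continuous.mul (by fun_prop) (Continuous.inv₀ (by fun_prop) hden)
  have hlim : Tendsto (fun n => ∮ z in C(a, R), (z - w)⁻¹ • F n z) atTop
      (𝓝 (∮ z in C(a, R), (z - w)⁻¹ • f z)) := by
    simp only [circleIntegral, smul_eq_mul, ← mul_assoc]
    refine intervalIntegral.tendsto_integral_filter_of_dominated_convergence
      (fun θ => ‖deriv (circleMap a R) θ * (circleMap a R θ - w)⁻¹‖ * C)
      (Eventually.of_forall fun n => (hker.mul (hcont n)).aestronglyMeasurable)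
      (Eventually.of_forall fun n => ae_of_all _ fun θ _ => ?_)
      ((hker.norm.mul continuous_const).intervalIntegrable _ _)
      (ae_of_all _ fun θ _ => (hf _ (hcircle θ)).const_mul _)
    rw [norm_mul]
    gcongr
    exact hC n _ (hcircle θ)
  refine tendsto_nhds_unique (hf w (hsub (Metric.ball_subset_closedBall hw))) ?_
  simp only [hcauchy]
  exact hlim.const_smul _

end BoundedLimit

/-! ### Graphs of negative subspaces and their convergence. -/

section Graph

open Filter Matrix

variable {c d : ℕ}

theorem signatureForm_nonneg_of_inr_eq_zero {v : Fin c ⊕ Fin d → ℂ}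
    (hv : ∀ j, v (Sum.inr j) = 0) : 0 ≤ signatureForm v := by
  simp only [signatureForm, hv]
  simp only [norm_zero, ne_eq, OfNat.ofNat_ne_zero, not_false_eq_true, zero_pow,
    Finset.sum_const_zero, sub_zero]
  positivity

theorem signatureForm_neg_of_inl_eq_zero {v : Fin c ⊕ Fin d → ℂ}
    (hv : ∀ i, v (Sum.inl i) = 0) (hv0 : v ≠ 0) : signatureForm v < 0 := by
  have h := sum_norm_sq_add_sum_norm_sq_pos hv0
  simp only [signatureForm, hv] at h ⊢
  simpa using h

theorem mulVec_sumElim_zero (A : Matrix (Fin c ⊕ Fin d) (Fin c ⊕ Fin d) ℂ) (y : Fin d → ℂ) :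
    A *ᵥ Sum.elim 0 y = Sum.elim (A.toBlocks₁₂ *ᵥ y) (A.toBlocks₂₂ *ᵥ y) := by
  conv_lhs => rw [← Matrix.fromBlocks_toBlocks A, Matrix.fromBlocks_mulVec]
  simp

/-- The matrix `X` such that the subspace spanned by the columns of `A * [0; 1]` is spanned by the
columns of `[X; 1]`. -/
noncomputable def graphMatrix (A : Matrix (Fin c ⊕ Fin d) (Fin c ⊕ Fin d) ℂ) :
    Matrix (Fin c) (Fin d) ℂ :=
  A.toBlocks₁₂ * A.toBlocks₂₂⁻¹

section Contraction

variable {A : Matrix (Fin c ⊕ Fin d) (Fin c ⊕ Fin d) ℂ} {r : ℝ}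

/-- A kernel vector y would give a vector (0, y) of negative form whose image has no negative part.
-/
theorem det_toBlocks₂₂_ne_zero (hr : 0 < r)
    (hA : ∀ v, signatureForm (A *ᵥ v) ≤ r ^ 2 * signatureForm v) : A.toBlocks₂₂.det ≠ 0 := by
  intro h0
  obtain ⟨y, hy, hy0⟩ := Matrix.exists_mulVec_eq_zero_iff.2 h0
  have h1 := hA (Sum.elim 0 y)
  have h2 : 0 ≤ signatureForm (A *ᵥ Sum.elim 0 y) :=
    signatureForm_nonneg_of_inr_eq_zero fun j => by simp [mulVec_sumElim_zero, hy0]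
  have h3 : signatureForm (Sum.elim (0 : Fin c → ℂ) y) < 0 :=
    signatureForm_neg_of_inl_eq_zero (by simp) fun h => hy (funext fun j => congrFun h (Sum.inr j))
  nlinarith [mul_neg_of_pos_of_neg (pow_pos hr 2) h3]

theorem mulVec_sumElim_inv_toBlocks₂₂ (hdet : A.toBlocks₂₂.det ≠ 0) (x : Fin d → ℂ) :
    A *ᵥ Sum.elim 0 (A.toBlocks₂₂⁻¹ *ᵥ x) = Sum.elim (graphMatrix A *ᵥ x) x := by
  rw [mulVec_sumElim_zero, Matrix.mulVec_mulVec, Matrix.mulVec_mulVec,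
    Matrix.mul_nonsing_inv _ hdet.isUnit, Matrix.one_mulVec, graphMatrix]

/-- This is the form inequality at (0, A₂₂⁻¹x), whose image is (Xx, x). It bounds the graph matrix X
and r A₂₂⁻¹ at once; both bounds are needed for the limit. -/
theorem sum_norm_sq_graphMatrix_mulVec_add_le (hr : 0 < r)
    (hA : ∀ v, signatureForm (A *ᵥ v) ≤ r ^ 2 * signatureForm v) (x : Fin d → ℂ) :
    ∑ i, ‖(graphMatrix A *ᵥ x) i‖ ^ 2 + r ^ 2 * ∑ j, ‖(A.toBlocks₂₂⁻¹ *ᵥ x) j‖ ^ 2 ≤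
      ∑ j, ‖x j‖ ^ 2 := by
  have h := hA (Sum.elim 0 (A.toBlocks₂₂⁻¹ *ᵥ x))
  rw [mulVec_sumElim_inv_toBlocks₂₂ (det_toBlocks₂₂_ne_zero hr hA)] at h
  simp only [signatureForm, Sum.elim_inl, Sum.elim_inr, Pi.zero_apply, norm_zero, ne_eq,
    OfNat.ofNat_ne_zero, not_false_eq_true, zero_pow, Finset.sum_const_zero, zero_sub] at h
  linarith

theorem norm_graphMatrix_apply_le (hr : 0 < r)
    (hA : ∀ v, signatureForm (A *ᵥ v) ≤ r ^ 2 * signatureForm v) (i : Fin c) (j : Fin d) :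
    ‖graphMatrix A i j‖ ≤ 1 := by
  have h := sum_norm_sq_graphMatrix_mulVec_add_le hr hA (Pi.single j 1)
  have h1 : ∑ k, ‖(Pi.single j 1 : Fin d → ℂ) k‖ ^ 2 = 1 := by
    rw [Finset.sum_eq_single j] <;> simp +contextual
  have h2 := Finset.single_le_sum
    (f := fun i => ‖(graphMatrix A *ᵥ Pi.single j 1) i‖ ^ 2) (fun _ _ => by positivity)
    (Finset.mem_univ i)
  have h3 : 0 ≤ r ^ 2 * ∑ k, ‖(A.toBlocks₂₂⁻¹ *ᵥ Pi.single j 1) k‖ ^ 2 := by positivity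
  rw [h1] at h
  simp only [Matrix.mulVec_single_one, Matrix.col_apply] at h h2 h3
  exact (sq_le_one_iff₀ (norm_nonneg _)).1 (by linarith)

end Contraction

theorem graphMap_one_apply (K : Matrix (Fin c) (Fin d) ℂ) (x : Fin d → ℂ) :
    graphMap 1 K x = Sum.elim (K *ᵥ x) x := by
  simp [graphMap, Matrix.fromRows_mulVec]

namespace IsStrictLyapunov

variable {f : Module.End ℂ (Fin c ⊕ Fin d → ℂ)} {s : ℝ}

/-- Negativity makes the projection to the last d coordinates injective on the unstable subspace,
and nonnegativity makes the projection to the first c injective on the stable one. The dimensions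
add up to c + d, so both bounds are sharp. -/
theorem finrank_unstableSubspace (h : IsStrictLyapunov f s signatureForm) :
    Module.finrank ℂ (unstableSubspace f s) = d := by
  have h1 : Module.finrank ℂ (unstableSubspace f s) ≤ d := by
    let p : unstableSubspace f s →ₗ[ℂ] (Fin d → ℂ) :=
      LinearMap.funLeft ℂ ℂ Sum.inr ∘ₗ (unstableSubspace f s).subtype
    have hp : Function.Injective p := by
      refine (injective_iff_map_eq_zero p).2 fun v hv => ?_
      by_contra hv0
      exact absurd (h.neg_of_mem_unstableSubspace v.2 fun h0 => hv0 (Subtype.ext h0))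
        (signatureForm_nonneg_of_inr_eq_zero fun j => congrFun hv j).not_gt
    simpa using LinearMap.finrank_le_finrank_of_injective hp
  have h2 : Module.finrank ℂ (stableSubspace f s) ≤ c := by
    let p : stableSubspace f s →ₗ[ℂ] (Fin c → ℂ) :=
      LinearMap.funLeft ℂ ℂ Sum.inl ∘ₗ (stableSubspace f s).subtype
    have hp : Function.Injective p := by
      refine (injective_iff_map_eq_zero p).2 fun v hv => ?_
      by_contra hv0
      exact absurd (h.nonneg_of_mem_stableSubspace v.2)
        (signatureForm_neg_of_inl_eq_zero (fun i => congrFun hv i)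
          fun h0 => hv0 (Subtype.ext h0)).not_ge
    simpa using LinearMap.finrank_le_finrank_of_injective hp
  have h3 := Submodule.finrank_add_eq_of_isCompl h.isCompl
  simp only [Module.finrank_fintype_fun_eq_card, Fintype.card_sum, Fintype.card_fin] at h3
  omega

theorem exists_unstableSubspace_eq_range_graphMap (h : IsStrictLyapunov f s signatureForm) :
    ∃ K : Matrix (Fin c) (Fin d) ℂ, unstableSubspace f s = LinearMap.range (graphMap 1 K) := by
  let p : unstableSubspace f s →ₗ[ℂ] (Fin d → ℂ) :=
    LinearMap.funLeft ℂ ℂ Sum.inr ∘ₗ (unstableSubspace f s).subtype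
  have hp : Function.Injective p := by
    refine (injective_iff_map_eq_zero p).2 fun v hv => ?_
    by_contra hv0
    exact absurd (h.neg_of_mem_unstableSubspace v.2 fun h0 => hv0 (Subtype.ext h0))
      (signatureForm_nonneg_of_inr_eq_zero fun j => congrFun hv j).not_gt
  let e := LinearEquiv.ofInjectiveOfFinrankEq p hp (by simp [h.finrank_unstableSubspace])
  have he : ∀ v j, e v j = (v : Fin c ⊕ Fin d → ℂ) (Sum.inr j) := fun v j => rfl
  let K := LinearMap.toMatrix' (LinearMap.funLeft ℂ ℂ Sum.inl ∘ₗ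
    (unstableSubspace f s).subtype ∘ₗ e.symm.toLinearMap)
  have hK : ∀ x, graphMap 1 K x = e.symm x := by
    intro x
    rw [graphMap_one_apply]
    funext k
    rcases k with i | j
    · simp [K, LinearMap.toMatrix'_mulVec, LinearMap.funLeft]
    · rw [← he, LinearEquiv.apply_symm_apply, Sum.elim_inr]
  refine ⟨K, le_antisymm (fun v hv => ⟨e ⟨v, hv⟩, by simp [hK]⟩) ?_⟩
  rintro _ ⟨x, rfl⟩
  rw [hK]
  exact (e.symm x).2

/-- The error is ℓ(f^k(0, y_k)), where ℓ vanishes on the graph of K. As the unstable subspace is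
invariant, only the stable components of the basis vectors contribute. Their iterates are o(s^k),
whereas the coordinates of y_k are at most s^(-k). -/
theorem tendsto_graphMatrix_pow (h : IsStrictLyapunov f s signatureForm)
    {K : Matrix (Fin c) (Fin d) ℂ} (hK : unstableSubspace f s = LinearMap.range (graphMap 1 K))
    (i : Fin c) (j : Fin d) :
    Tendsto (fun k => graphMatrix (LinearMap.toMatrix' f ^ k) i j) atTop (𝓝 (K i j)) := by
  set A := LinearMap.toMatrix' f
  have hAf : ∀ k v, (A ^ k) *ᵥ v = (f ^ k) v := fun k v => by
    induction k with
    | zero => simp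
    | succ k ih =>
      rw [pow_succ', ← Matrix.mulVec_mulVec, ih, LinearMap.toMatrix'_mulVec, pow_succ',
        Module.End.mul_apply]
  have hA : ∀ k v, signatureForm ((A ^ k) *ᵥ v) ≤ (s ^ k) ^ 2 * signatureForm v := fun k v => by
    rw [hAf]
    exact h.pow_le v k
  have hs : ∀ k, 0 < s ^ k := fun k => pow_pos h.pos k
  let x : Fin d → ℂ := Pi.single j 1
  let y : ℕ → Fin d → ℂ := fun k => (A ^ k).toBlocks₂₂⁻¹ *ᵥ x
  -- the linear form which measures the distance to the graph of `K`
  let ℓ : (Fin c ⊕ Fin d → ℂ) →ₗ[ℂ] ℂ :=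
    LinearMap.proj (Sum.inl i) -
      LinearMap.proj i ∘ₗ K.mulVecLin ∘ₗ LinearMap.funLeft ℂ ℂ Sum.inr
  have hℓ : ∀ (a : Fin c → ℂ) (b : Fin d → ℂ), ℓ (Sum.elim a b) = a i - (K *ᵥ b) i :=
    fun a b => rfl
  have hℓ0 : ∀ v ∈ unstableSubspace f s, ℓ v = 0 := by
    intro v hv
    rw [hK] at hv
    obtain ⟨b, rfl⟩ := hv
    rw [graphMap_one_apply, hℓ, sub_self]
  have hsplit : ∀ v, ∃ w ∈ stableSubspace f s, ∀ k, ℓ ((f ^ k) v) = ℓ ((f ^ k) w) := by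
    intro v
    obtain ⟨w, hw, u, hu, rfl⟩ := Submodule.mem_sup.1
      (h.isCompl.sup_eq_top ▸ Submodule.mem_top : v ∈ stableSubspace f s ⊔ unstableSubspace f s)
    refine ⟨w, hw, fun k => ?_⟩
    have huk : (f ^ k) u ∈ unstableSubspace f s := by
      induction k with
      | zero => simpa using hu
      | succ k ih =>
        rw [pow_succ', Module.End.mul_apply]
        exact map_mem_biSup_maxGenEigenspace f _ ih
    rw [_root_.map_add, _root_.map_add, hℓ0 _ huk, add_zero]
  choose w hw hwℓ using hsplit
  let b : Fin d → Fin c ⊕ Fin d → ℂ := fun m => Sum.elim 0 (Pi.single m 1)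
  have hy : ∀ k, (Sum.elim 0 (y k) : Fin c ⊕ Fin d → ℂ) = ∑ m, y k m • b m := by
    intro k
    funext l
    rcases l with l | l
    · simp [b, Finset.sum_apply]
    · simp [b, Finset.sum_apply, Pi.single_apply]
  have hdiff : ∀ k, graphMatrix (A ^ k) i j - K i j =
      ∑ m, ((s : ℂ) ^ k * y k m) * ℓ (((s : ℂ) ^ k)⁻¹ • (f ^ k) (w (b m))) := by
    intro k
    have hsk : ((s : ℂ) ^ k) ≠ 0 := pow_ne_zero _ (by exact_mod_cast h.pos.ne')
    have h1 := congrArg ℓ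
      (mulVec_sumElim_inv_toBlocks₂₂ (det_toBlocks₂₂_ne_zero (hs k) (hA k)) x)
    rw [hℓ, hAf] at h1
    simp only [x, Matrix.mulVec_single_one, Matrix.col_apply] at h1
    rw [← h1, show (Sum.elim (0 : Fin c → ℂ) ((A ^ k).toBlocks₂₂⁻¹.col j) : Fin c ⊕ Fin d → ℂ) =
      Sum.elim (0 : Fin c → ℂ) (y k) by simp [y, x], hy, _root_.map_sum, _root_.map_sum]
    refine Finset.sum_congr rfl fun m _ => ?_
    rw [_root_.map_smul, _root_.map_smul, hwℓ, _root_.map_smul, smul_eq_mul, smul_eq_mul]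
    field_simp
  have hbound : ∀ k m, ‖(s : ℂ) ^ k * y k m‖ ≤ 1 := by
    intro k m
    have h1 := sum_norm_sq_graphMatrix_mulVec_add_le (hs k) (hA k) x
    have h2 : ∑ m, ‖x m‖ ^ 2 = 1 := by
      rw [Finset.sum_eq_single j] <;> simp +contextual [x]
    have h3 : 0 ≤ ∑ i, ‖(graphMatrix (A ^ k) *ᵥ x) i‖ ^ 2 := by positivity
    have h4 := Finset.single_le_sum (f := fun m => ‖y k m‖ ^ 2) (fun _ _ => by positivity)
      (Finset.mem_univ m)
    have h5 : (s ^ k) ^ 2 * ‖y k m‖ ^ 2 ≤ (s ^ k) ^ 2 * ∑ m, ‖y k m‖ ^ 2 := by gcongr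
    rw [norm_mul, norm_pow, Complex.norm_real, Real.norm_of_nonneg h.pos.le]
    refine (sq_le_one_iff₀ (by have := h.pos; positivity)).1 ?_
    rw [mul_pow]
    linarith
  rw [tendsto_iff_norm_sub_tendsto_zero]
  simp only [hdiff]
  have hterm : ∀ m, Tendsto (fun k =>
      ((s : ℂ) ^ k * y k m) * ℓ (((s : ℂ) ^ k)⁻¹ • (f ^ k) (w (b m)))) atTop (𝓝 0) := by
    intro m
    have hlim : Tendsto (fun k => ℓ (((s : ℂ) ^ k)⁻¹ • (f ^ k) (w (b m)))) atTop (𝓝 0) := by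
      have := (ℓ.continuous_of_finiteDimensional.tendsto 0).comp
        (tendsto_iterate_of_mem_stableSubspace f h.pos (hw (b m)))
      rwa [_root_.map_zero] at this
    refine squeeze_zero_norm (fun k => ?_) (by simpa only [norm_zero] using hlim.norm)
    rw [norm_mul]
    exact mul_le_of_le_one_left (norm_nonneg _) (hbound k m)
  simpa using (tendsto_finsetSum Finset.univ fun m _ => hterm m).norm

end IsStrictLyapunov

end Graph

/-! ### Triangular bases. -/

section Triangular

open Module

variable {V : Type*} [AddCommGroup V] [Module ℂ V]

theorem Module.Basis.repr_mkFinCons_of_mem {n : ℕ} {N : Submodule ℂ V} (y : V)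
    (b : Basis (Fin n) ℂ N) (hli : ∀ (c : ℂ), ∀ x ∈ N, c • y + x = 0 → c = 0)
    (hsp : ∀ z : V, ∃ c : ℂ, z + c • y ∈ N) (x : N) :
    (Basis.mkFinCons y b hli hsp).repr x 0 = 0 ∧
      ∀ i : Fin n, (Basis.mkFinCons y b hli hsp).repr x i.succ = b.repr x i := by
  set B := Basis.mkFinCons y b hli hsp with hB
  have hb : ∀ k, (b k : V) = B k.succ := fun k => by simp [hB]
  constructor
  · have : B.coord 0 ∘ₗ N.subtype = 0 := b.ext fun k => by simp [hb]
    exact LinearMap.congr_fun this x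
  · intro i
    have : B.coord i.succ ∘ₗ N.subtype = b.coord i := b.ext fun k => by
      simp [hb, Finsupp.single_apply]
    exact LinearMap.congr_fun this x

/-- An eigenvector of the dual map has an invariant hyperplane as its kernel. A vector outside it is
put first, and the induction continues in the hyperplane. -/
theorem exists_basis_isLowerTriangular [FiniteDimensional ℂ V] (f : Module.End ℂ V) {n : ℕ}
    (hn : finrank ℂ V = n) :
    ∃ b : Basis (Fin n) ℂ V, ∀ i j, i < j → b.repr (f (b j)) i = 0 := by
  induction n generalizing V with
  | zero => exact ⟨finBasisOfFinrankEq ℂ V hn, fun i => i.elim0⟩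
  | succ n ih =>
    have : Nontrivial V := nontrivial_of_finrank_pos (R := ℂ) (by omega)
    obtain ⟨lam, hlam⟩ := Module.End.exists_eigenvalue (K := ℂ) (V := Dual ℂ V) f.dualMap
    obtain ⟨φ, hφ⟩ := hlam.exists_hasEigenvector
    have hφf : ∀ v, φ (f v) = lam * φ v := fun v =>
      LinearMap.congr_fun hφ.apply_eq_smul v
    obtain ⟨y, hy⟩ : ∃ y, φ y ≠ 0 := by
      by_contra! h
      exact hφ.2 (LinearMap.ext h)
    let N := LinearMap.ker φ
    have hfN : ∀ v ∈ N, f v ∈ N := fun v hv => by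
      rw [LinearMap.mem_ker] at hv ⊢
      rw [hφf, hv, mul_zero]
    have hNn : finrank ℂ N = n := by
      have h : finrank ℂ N + 1 = finrank ℂ V := Module.Dual.finrank_ker_add_one_of_ne_zero hφ.2
      omega
    obtain ⟨b, hb⟩ := ih (f.restrict hfN) hNn
    have hli : ∀ (c : ℂ), ∀ x ∈ N, c • y + x = 0 → c = 0 := by
      intro c x hx h
      have := congrArg φ h
      rw [map_add, map_smul, LinearMap.mem_ker.1 hx, add_zero, map_zero, smul_eq_mul] at this
      exact (mul_eq_zero.1 this).resolve_right hy
    have hsp : ∀ z : V, ∃ c : ℂ, z + c • y ∈ N := fun z => ⟨-(φ z / φ y), by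
      rw [LinearMap.mem_ker, map_add, map_smul, smul_eq_mul]
      field_simp
      ring⟩
    refine ⟨Basis.mkFinCons y b hli hsp, fun i j hij => ?_⟩
    obtain ⟨j, rfl⟩ := Fin.exists_succ_eq_of_ne_zero (Fin.ne_zero_of_lt hij)
    have hj : f (Basis.mkFinCons y b hli hsp j.succ) = (f.restrict hfN (b j) : N) := by simp
    rw [hj]
    obtain ⟨h0, hs⟩ := Basis.repr_mkFinCons_of_mem y b hli hsp (f.restrict hfN (b j))
    refine Fin.cases (fun _ => h0) (fun i hij => ?_) i hij
    rw [hs]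
    exact hb i j (Fin.succ_lt_succ_iff.1 hij)

variable {n : ℕ} {f : Module.End ℂ V} {b : Basis (Fin n) ℂ V}

theorem det_eq_prod_of_isLowerTriangular (hb : ∀ i j, i < j → b.repr (f (b j)) i = 0) :
    LinearMap.det f = ∏ i, b.repr (f (b i)) i := by
  rw [← LinearMap.det_toMatrix b, Matrix.det_of_isLowerTriangular]
  · simp [LinearMap.toMatrix_apply]
  · intro i j hij
    rw [LinearMap.toMatrix_apply]
    exact hb i j hij

theorem hasEigenvalue_of_isLowerTriangular [FiniteDimensional ℂ V]
    (hb : ∀ i j, i < j → b.repr (f (b j)) i = 0) (k : Fin n) :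
    f.HasEigenvalue (b.repr (f (b k)) k) := by
  rw [Module.End.hasEigenvalue_iff_mem_spectrum, spectrum.mem_iff, LinearMap.isUnit_iff_isUnit_det,
    det_eq_prod_of_isLowerTriangular (b := b), Finset.prod_eq_zero (Finset.mem_univ k)]
  · exact not_isUnit_zero
  · simp
  · intro i j hij
    simp [hb i j hij, hij.ne]

end Triangular

/-! ### Eigenvalues of exterior powers. -/

section ExteriorEigenvalues

open Module Set

variable {V : Type*} [AddCommGroup V] [Module ℂ V]

theorem Module.Basis.exteriorPower_repr_map {ι : Type*} [LinearOrder ι] (b : Basis ι ℂ V) (k : ℕ)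
    (f : Module.End ℂ V) (I J : powersetCard ι k) :
    (b.exteriorPower k).repr (exteriorPower.map k f (b.exteriorPower k J)) I =
      (Matrix.of fun i j => b.repr (f (b (powersetCard.ofFinEmbEquiv.symm J i)))
        (powersetCard.ofFinEmbEquiv.symm I j)).det := by
  rw [exteriorPower.basis_repr_apply, exteriorPower.basis_apply,
    exteriorPower.map_apply_ιMulti_family, exteriorPower.ιMulti_family,
    exteriorPower.ιMultiDual_apply_ιMulti]
  rfl

/-- The entries of Λ^k f are minors of f. Summing w over index sets makes Λ^k f triangular with
respect to the total weight, and at an index of least weight in the support of an eigenvector only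
the diagonal entry acts. The linear order on `ι` only lists the subsets and need not agree with w.
-/
theorem exists_embedding_of_hasEigenvalue_exteriorPower_map {ι : Type*} [Fintype ι] [LinearOrder ι]
    (b : Basis ι ℂ V) (f : Module.End ℂ V) (w : ι → ℕ)
    (hw : ∀ i j, i ≠ j → b.repr (f (b j)) i ≠ 0 → w j < w i) {k : ℕ} {μ : ℂ}
    (hμ : Module.End.HasEigenvalue (exteriorPower.map k f : Module.End ℂ (⋀[ℂ]^k V)) μ) :
    ∃ e : Fin k ↪ ι, μ = ∏ a, b.repr (f (b (e a))) (e a) := by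
  classical
  let B := b.exteriorPower k
  let em : powersetCard ι k → Fin k ↪o ι := fun I => powersetCard.ofFinEmbEquiv.symm I
  have hem : Function.Injective em := powersetCard.ofFinEmbEquiv.symm.injective
  let wt : powersetCard ι k → ℕ := fun I => ∑ a, w (em I a)
  have hentry : ∀ I J, B.repr (exteriorPower.map k f (B J)) I =
      (Matrix.of fun i j => b.repr (f (b (em J i))) (em I j)).det := fun I J =>
    b.exteriorPower_repr_map k f I J
  have hσ : ∀ (I J) (σ : Equiv.Perm (Fin k)), wt I ≤ wt J →
      (∀ a, b.repr (f (b (em J (σ a)))) (em I a) ≠ 0) → ∀ a, em J (σ a) = em I a := by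
    intro I J σ hIJ hne
    have hle : ∀ a, w (em J (σ a)) ≤ w (em I a) := fun a => by
      by_cases h : em I a = em J (σ a)
      · rw [h]
      · exact (hw _ _ h (hne a)).le
    have hsum : ∑ a, w (em J (σ a)) = ∑ a, w (em I a) :=
      le_antisymm (Finset.sum_le_sum fun a _ => hle a)
        (hIJ.trans (Equiv.sum_comp σ fun a => w (em J a)).ge)
    intro a
    by_contra h
    exact (hw _ _ (Ne.symm h) (hne a)).ne
      ((Finset.sum_eq_sum_iff_of_le fun a _ => hle a).1 hsum a (Finset.mem_univ a))
  have hoff : ∀ I J, I ≠ J → wt I ≤ wt J → B.repr (exteriorPower.map k f (B J)) I = 0 := by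
    intro I J hne hIJ
    rw [hentry, Matrix.det_apply]
    refine Finset.sum_eq_zero fun σ _ => ?_
    by_contra h
    have h1 := hσ I J σ hIJ fun a h0 => h (by
      rw [Finset.prod_eq_zero (Finset.mem_univ a) (by simpa using h0), smul_zero])
    refine hne (powersetCard.ofFinEmbEquiv.symm.injective ?_)
    have hrange : Set.range (em I) = Set.range (em J) := by
      have : (em I : Fin k → ι) = em J ∘ σ := funext fun a => (h1 a).symm
      rw [this, σ.surjective.range_comp]
    exact OrderEmbedding.range_inj.1 hrange
  have hdiag : ∀ I, B.repr (exteriorPower.map k f (B I)) I =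
      ∏ a, b.repr (f (b (em I a))) (em I a) := by
    intro I
    rw [hentry, Matrix.det_apply, Finset.sum_eq_single 1]
    · simp
    · intro σ _ hne
      by_contra h
      have h1 := hσ I I σ le_rfl fun a h0 => h (by
        rw [Finset.prod_eq_zero (Finset.mem_univ a) (by simpa using h0), smul_zero])
      exact hne (Equiv.ext fun a => (em I).injective (h1 a))
    · simp
  obtain ⟨ω, hω⟩ := hμ.exists_hasEigenvector
  obtain ⟨I, hI, hmin⟩ := Set.exists_min_image {I | B.repr ω I ≠ 0} wt (Set.toFinite _) (by
    by_contra h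
    rw [Set.not_nonempty_iff_eq_empty] at h
    refine hω.2 (B.ext_elem fun I => ?_)
    by_contra h0
    have : I ∈ {I | B.repr ω I ≠ 0} := by simpa using h0
    simp [h] at this)
  refine ⟨(em I).toEmbedding, mul_right_cancel₀ hI ?_⟩
  have h1 : B.repr (exteriorPower.map k f ω) I = μ * B.repr ω I := by
    rw [hω.apply_eq_smul]
    simp
  rw [← h1]
  conv_lhs => rw [← B.sum_repr ω, map_sum, map_sum, Finsupp.finsetSum_apply]
  rw [Finset.sum_eq_single I]
  · rw [map_smul, map_smul, Finsupp.smul_apply, hdiag, smul_eq_mul, mul_comm]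
    rfl
  · intro J _ hne
    rw [map_smul, map_smul, Finsupp.smul_apply]
    by_cases hJ : B.repr ω J = 0
    · rw [hJ, zero_smul]
    · rw [hoff I J hne.symm (hmin J hJ), smul_zero]
  · simp

/-- The wedge of a basis of W is an eigenvector, because every alternating k-form on W is a multiple
of the determinant. It is nonzero because that determinant extends to V through a projection onto W.
-/
theorem hasEigenvalue_exteriorPower_map_det [FiniteDimensional ℂ V] {f : Module.End ℂ V}
    {W : Submodule ℂ V} (hW : ∀ v ∈ W, f v ∈ W) {k : ℕ} (hk : finrank ℂ W = k) :
    Module.End.HasEigenvalue (exteriorPower.map k f : Module.End ℂ (⋀[ℂ]^k V))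
      (LinearMap.det (f.restrict hW)) := by
  classical
  let b : Basis (Fin k) ℂ W := finBasisOfFinrankEq ℂ W hk
  refine Module.End.hasEigenvalue_of_hasEigenvector
    (x := exteriorPower.ιMulti ℂ k fun i => (b i : V)) ⟨?_, ?_⟩
  · rw [Module.End.mem_eigenspace_iff, exteriorPower.map_apply_ιMulti, ← sub_eq_zero,
      ← Module.forall_dual_apply_eq_zero_iff ℂ]
    intro φ
    let g : W [⋀^Fin k]→ₗ[ℂ] ℂ :=
      φ.compAlternatingMap ((exteriorPower.ιMulti ℂ k).compLinearMap W.subtype)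
    have h1 : g (f.restrict hW ∘ b) = LinearMap.det (f.restrict hW) * g b := by
      conv_lhs => rw [AlternatingMap.eq_smul_basis_det b g]
      rw [AlternatingMap.smul_apply, Basis.det_comp, Basis.det_self, mul_one, smul_eq_mul, mul_comm]
    rw [map_sub, map_smul, sub_eq_zero]
    exact h1
  · obtain ⟨p, hp⟩ := LinearMap.exists_leftInverse_of_injective W.subtype W.ker_subtype
    intro h0
    have h1 := exteriorPower.alternatingMapLinearEquiv_apply_ιMulti (b.det.compLinearMap p)
      fun i => (b i : V)
    have h2 : (⇑p ∘ fun i => (b i : V)) = b := funext fun i => LinearMap.congr_fun hp (b i)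
    rw [h0, map_zero, AlternatingMap.compLinearMap_apply] at h1
    have h3 : (fun i => p (b i : V)) = b := h2
    simp only [h3, Basis.det_self] at h1
    exact zero_ne_one h1

end ExteriorEigenvalues

/-! ### The spectral radius of an exterior power. -/

section SpectralRadius

open Module

variable {V : Type*} [AddCommGroup V] [Module ℂ V] [FiniteDimensional ℂ V]

theorem exists_spectralRadius_toReal_eq_norm [Nontrivial V] (f : Module.End ℂ V) :
    ∃ μ ∈ spectrum ℂ f, (spectralRadius ℂ f).toReal = ‖μ‖ ∧ ∀ ν ∈ spectrum ℂ f, ‖ν‖ ≤ ‖μ‖ := by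
  obtain ⟨μ, hμ, hmax⟩ := Set.exists_max_image (spectrum ℂ f) (fun ν => ‖ν‖)
    (Module.End.finite_spectrum f) (spectrum.nonempty_of_isAlgClosed_of_finiteDimensional ℂ f)
  refine ⟨μ, hμ, ?_, hmax⟩
  have : spectralRadius ℂ f = ‖μ‖₊ :=
    le_antisymm (iSup₂_le fun ν hν => by exact_mod_cast hmax ν hν)
      (le_iSup₂ (f := fun ν (_ : ν ∈ spectrum ℂ f) => (‖ν‖₊ : ENNReal)) μ hμ)
  simp [this]

theorem nontrivial_exteriorPower {k : ℕ} (hk : k ≤ finrank ℂ V) : Nontrivial (⋀[ℂ]^k V) := by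
  refine nontrivial_of_finrank_pos (R := ℂ) ?_
  rw [exteriorPower.finrank_eq]
  exact Nat.choose_pos hk

theorem exteriorSpectralRadius_pos {k : ℕ} (hk : k ≤ finrank ℂ V) {f : Module.End ℂ V}
    (hf : IsUnit f) : 0 < exteriorSpectralRadius k f := by
  have := nontrivial_exteriorPower hk
  obtain ⟨μ, hμ, h, -⟩ := exists_spectralRadius_toReal_eq_norm
    (exteriorPower.map k f : Module.End ℂ (⋀[ℂ]^k V))
  rw [exteriorSpectralRadius, h, norm_pos_iff]
  rintro rfl
  obtain ⟨g, hg⟩ := hf.exists_left_inv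
  obtain ⟨g', hg'⟩ := hf.exists_right_inv
  refine spectrum.zero_notMem_iff ℂ |>.2 ?_ hμ
  refine isUnit_iff_exists_and_exists.2 ⟨⟨exteriorPower.map k g', ?_⟩, ⟨exteriorPower.map k g, ?_⟩⟩
  · rw [Module.End.mul_eq_comp, ← exteriorPower.map_comp, ← Module.End.mul_eq_comp, hg',
      Module.End.one_eq_id, exteriorPower.map_id]
    rfl
  · rw [Module.End.mul_eq_comp, ← exteriorPower.map_comp, ← Module.End.mul_eq_comp, hg,
      Module.End.one_eq_id, exteriorPower.map_id]
    rfl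

/-- After cancelling the common indices, the power of s with exponent |S \ L| = |L \ S| separates
the two products. -/
theorem Finset.prod_le_prod_of_card_eq {ι : Type*} [DecidableEq ι] {S L : Finset ι} {x : ι → ℝ}
    {s : ℝ} (hs : 0 ≤ s) (hcard : S.card = L.card) (hx : ∀ i, 0 ≤ x i)
    (hL : ∀ i ∈ L, s ≤ x i) (hS : ∀ i ∉ L, x i ≤ s) : ∏ i ∈ S, x i ≤ ∏ i ∈ L, x i := by
  rw [← Finset.prod_inter_mul_prod_sdiff S L, ← Finset.prod_inter_mul_prod_sdiff L S,
    Finset.inter_comm]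
  refine mul_le_mul_of_nonneg_left ?_ (Finset.prod_nonneg fun i _ => hx i)
  calc _ ≤ ∏ i ∈ S \ L, s :=
        Finset.prod_le_prod (fun i _ => hx i) fun i hi => hS i (Finset.mem_sdiff.1 hi).2
    _ = ∏ i ∈ L \ S, s := by
        rw [Finset.prod_const, Finset.prod_const, Finset.card_sdiff_comm hcard]
    _ ≤ _ := Finset.prod_le_prod (fun i _ => hs) fun i hi => hL i (Finset.mem_sdiff.1 hi).1

/-- If `W` and `E` are complementary invariant subspaces, the eigenvalues on `W` have absolute
value at least `s` and those on `E` at most `s`, then the spectral radius of `Λ^k f`, where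
`k = dim W`, is `|det f|_W|`. -/
theorem exteriorSpectralRadius_eq_norm_det {f : Module.End ℂ V} {W E : Submodule ℂ V}
    (hWE : IsCompl W E) (hW : ∀ v ∈ W, f v ∈ W) (hE : ∀ v ∈ E, f v ∈ E) {s : ℝ} (hs : 0 ≤ s)
    (hWs : ∀ μ, Module.End.HasEigenvalue (f.restrict hW) μ → s ≤ ‖μ‖)
    (hEs : ∀ μ, Module.End.HasEigenvalue (f.restrict hE) μ → ‖μ‖ ≤ s) {k : ℕ} (hk : finrank ℂ W = k) :
    exteriorSpectralRadius k f = ‖LinearMap.det (f.restrict hW)‖ := by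
  have : Nontrivial (⋀[ℂ]^k V) := nontrivial_exteriorPower (hk ▸ Submodule.finrank_le W)
  obtain ⟨μ, hμ, h, hmax⟩ := exists_spectralRadius_toReal_eq_norm
    (exteriorPower.map k f : Module.End ℂ (⋀[ℂ]^k V))
  rw [exteriorSpectralRadius, h]
  refine le_antisymm ?_ (hmax _
    (Module.End.hasEigenvalue_iff_mem_spectrum.1 (hasEigenvalue_exteriorPower_map_det hW hk)))
  obtain ⟨bW, hbW⟩ := exists_basis_isLowerTriangular (f.restrict hW) hk
  obtain ⟨bE, hbE⟩ := exists_basis_isLowerTriangular (f.restrict hE) rfl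
  let b : Basis (Fin k ⊕ Fin (finrank ℂ E)) ℂ V :=
    (bW.prod bE).map (Submodule.prodEquivOfIsCompl W E hWE)
  have hbl : ∀ i, b (Sum.inl i) = bW i := fun i => by simp [b]
  have hbr : ∀ i, b (Sum.inr i) = bE i := fun i => by simp [b]
  have hfW : ∀ x : W, b.repr x = (bW.prod bE).repr (x, 0) := fun x => by
    simp [b]
  have hfE : ∀ x : E, b.repr x = (bW.prod bE).repr (0, x) := fun x => by
    simp [b]
  have hcW : ∀ j, f (b (Sum.inl j)) = (f.restrict hW (bW j) : W) := fun j => by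
    rw [hbl, LinearMap.coe_restrict_apply]
  have hcE : ∀ j, f (b (Sum.inr j)) = (f.restrict hE (bE j) : E) := fun j => by
    rw [hbr, LinearMap.coe_restrict_apply]
  let : LinearOrder (Fin k ⊕ Fin (finrank ℂ E)) := LinearOrder.lift' finSumFinEquiv
    finSumFinEquiv.injective
  -- The weight is the position within one's own block. The blocks do not interact, by invariance of
  -- W and E.
  have htri : ∀ i j, i ≠ j → b.repr (f (b j)) i ≠ 0 →
      (Sum.elim Fin.val Fin.val j : ℕ) < Sum.elim Fin.val Fin.val i := by
    intro i j hij hne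
    rcases j with j | j
    · rw [hcW, hfW] at hne
      rcases i with i | i
      · simp only [Sum.elim_inl]
        by_contra hlt
        refine hne ?_
        simpa using hbW i j (lt_of_le_of_ne (not_lt.1 hlt) fun h => hij (congrArg _ h))
      · simp at hne
    · rw [hcE, hfE] at hne
      rcases i with i | i
      · simp at hne
      · simp only [Sum.elim_inr]
        by_contra hlt
        refine hne ?_
        simpa using hbE i j (lt_of_le_of_ne (not_lt.1 hlt) fun h => hij (congrArg _ h))
  obtain ⟨e, rfl⟩ := exists_embedding_of_hasEigenvalue_exteriorPower_map b f
    (Sum.elim Fin.val Fin.val) htri (Module.End.hasEigenvalue_iff_mem_spectrum.2 hμ)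
  have hdW : ∀ i, b.repr (f (b (Sum.inl i))) (Sum.inl i) =
      bW.repr (f.restrict hW (bW i)) i := fun i => by rw [hcW, hfW]; simp
  have hdE : ∀ i, b.repr (f (b (Sum.inr i))) (Sum.inr i) =
      bE.repr (f.restrict hE (bE i)) i := fun i => by rw [hcE, hfE]; simp
  rw [det_eq_prod_of_isLowerTriangular hbW, norm_prod, norm_prod]
  have := Finset.prod_le_prod_of_card_eq (S := Finset.univ.map e)
    (L := Finset.univ.map Function.Embedding.inl)
    (x := fun i => ‖b.repr (f (b i)) i‖) hs (by simp) (fun i => norm_nonneg _) ?_ ?_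
  · simpa [Finset.prod_map, hdW] using this
  · intro i hi
    obtain ⟨i, -, rfl⟩ := Finset.mem_map.1 hi
    simp only [Function.Embedding.inl_apply, hdW]
    exact hWs _ (hasEigenvalue_of_isLowerTriangular hbW i)
  · intro i hi
    rcases i with i | i
    · exact absurd (Finset.mem_map.2 ⟨i, Finset.mem_univ i, rfl⟩) hi
    · rw [hdE]
      exact hEs _ (hasEigenvalue_of_isLowerTriangular hbE i)

end SpectralRadius

/-! ### Continuity of the spectral radius. -/

section SpectralRadiusContinuity

open Filter Matrix

theorem pow_card_le_norm_prod_sub {lam : ℂ} {ε : ℝ} (hε : 0 ≤ ε) (s : Multiset ℂ)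
    (hs : ∀ r ∈ s, ε ≤ ‖lam - r‖) : ε ^ s.card ≤ ‖(s.map fun r => lam - r).prod‖ := by
  induction s using Multiset.induction_on with
  | empty => simp
  | cons a s ih =>
    rw [Multiset.card_cons, Multiset.map_cons, Multiset.prod_cons, norm_mul, pow_succ']
    have h1 := hs a (Multiset.mem_cons_self a s)
    have h2 := ih fun r hr => hs r (Multiset.mem_cons_of_mem hr)
    gcongr

/-- The characteristic polynomial at lam is the product of the differences from its roots; if all
were at least ε in modulus, it would be at least ε to the dimension. -/
theorem Matrix.exists_mem_spectrum_norm_sub_lt {J : Type*} [Fintype J] [DecidableEq J]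
    {A : Matrix J J ℂ} {lam : ℂ} {ε : ℝ} (hε : 0 < ε)
    (h : ‖(Matrix.scalar J lam - A).det‖ < ε ^ Fintype.card J) :
    ∃ μ ∈ spectrum ℂ A, ‖lam - μ‖ < ε := by
  by_contra! hne
  have hsplit : A.charpoly.Splits := IsAlgClosed.splits _
  have h1 := pow_card_le_norm_prod_sub (lam := lam) hε.le A.charpoly.roots fun r hr =>
    hne r (Matrix.mem_spectrum_iff_isRoot_charpoly.2 (Polynomial.isRoot_of_mem_roots hr))
  have h2 := hsplit.eval_eq_prod_roots lam
  rw [A.charpoly_monic.leadingCoeff, one_mul, Matrix.eval_charpoly] at h2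
  rw [← hsplit.natDegree_eq_card_roots, Matrix.charpoly_natDegree_eq_dim, ← h2] at h1
  exact h1.not_gt h

attribute [local instance] Matrix.linftyOpNormedRing Matrix.linftyOpNormedAlgebra in
theorem eventually_spectrum_subset_of_continuous {X J : Type*} [TopologicalSpace X] [Fintype J]
    [DecidableEq J] {G : X → Matrix J J ℂ} (hG : Continuous G) {x₀ : X} {u : Set ℂ}
    (hu : IsOpen u) (h : spectrum ℂ (G x₀) ⊆ u) : ∀ᶠ x in 𝓝 x₀, spectrum ℂ (G x) ⊆ u := by
  have h1 : UpperHemicontinuousAt (spectrum ℂ : Matrix J J ℂ → Set ℂ) (G x₀) :=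
    upperHemicontinuous_spectrum ℂ (Matrix J J ℂ) (G x₀)
  exact hG.continuousAt.eventually (upperHemicontinuousAt_iff_forall_isOpen.1 h1 u hu h)

/-- Lower semicontinuity: near an eigenvalue of largest modulus, nearby matrices keep an eigenvalue.
Upper semicontinuity: the spectrum cannot suddenly leave an open disc. -/
theorem continuous_of_eq_max_norm_spectrum {X J : Type*} [TopologicalSpace X] [Fintype J]
    [DecidableEq J] {G : X → Matrix J J ℂ} (hG : Continuous G) {R : X → ℝ}
    (hR : ∀ x, ∃ μ ∈ spectrum ℂ (G x), R x = ‖μ‖ ∧ ∀ ν ∈ spectrum ℂ (G x), ‖ν‖ ≤ ‖μ‖) :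
    Continuous R := by
  refine continuous_iff_continuousAt.2 fun x₀ => tendsto_order.2 ⟨fun a ha => ?_, fun a ha => ?_⟩
  · obtain ⟨lam, hlam, hR₀, -⟩ := hR x₀
    have hdet : Continuous fun x => ‖(Matrix.scalar J lam - G x).det‖ :=
      (Continuous.matrix_det (continuous_const.sub hG)).norm
    have h0 : ‖(Matrix.scalar J lam - G x₀).det‖ = 0 := by
      rw [norm_eq_zero, ← Matrix.eval_charpoly]
      exact Matrix.mem_spectrum_iff_isRoot_charpoly.1 hlam
    have hε : 0 < R x₀ - a := sub_pos.2 ha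
    have hev : ∀ᶠ x in 𝓝 x₀,
        ‖(Matrix.scalar J lam - G x).det‖ < (R x₀ - a) ^ Fintype.card J :=
      hdet.continuousAt.eventually_lt continuousAt_const (h0.trans_lt (pow_pos hε _))
    filter_upwards [hev] with x hx
    obtain ⟨μ, hμ, hlt⟩ := Matrix.exists_mem_spectrum_norm_sub_lt hε hx
    obtain ⟨ν, -, hRx, hmax⟩ := hR x
    have h1 := norm_sub_norm_le lam μ
    have h2 := hmax μ hμ
    rw [hRx]
    linarith
  · obtain ⟨lam, -, hR₀, hmax⟩ := hR x₀
    have h1 : spectrum ℂ (G x₀) ⊆ Metric.ball 0 a := fun ν hν => by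
      rw [mem_ball_zero_iff]
      exact (hmax ν hν).trans_lt (hR₀ ▸ ha)
    filter_upwards [eventually_spectrum_subset_of_continuous hG Metric.isOpen_ball h1] with x hx
    obtain ⟨μ, hμ, hRx, -⟩ := hR x
    rw [hRx]
    exact mem_ball_zero_iff.1 (hx hμ)

theorem continuous_exteriorSpectralRadius {X J : Type*} [TopologicalSpace X] [Fintype J]
    [DecidableEq J] {k : ℕ} (hk : k ≤ Fintype.card J) {A : X → Matrix J J ℂ} (hA : Continuous A) :
    Continuous fun x => exteriorSpectralRadius k (Matrix.toLin' (A x)) := by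
  classical
  let : LinearOrder J := LinearOrder.lift' (Fintype.equivFin J) (Fintype.equivFin J).injective
  have := nontrivial_exteriorPower (V := J → ℂ) (k := k) (by simpa using hk)
  let b := Pi.basisFun ℂ J
  let B := b.exteriorPower k
  have := Fintype.ofFinite (Set.powersetCard J k)
  refine continuous_of_eq_max_norm_spectrum
    (G := fun x => LinearMap.toMatrixAlgEquiv B (exteriorPower.map k (Matrix.toLin' (A x)))) ?_
    fun x => ?_
  · refine continuous_matrix fun I K => ?_
    simp only [LinearMap.toMatrixAlgEquiv_apply]
    simp only [B, Module.Basis.exteriorPower_repr_map]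
    refine Continuous.matrix_det (continuous_matrix fun i j => ?_)
    simp only [b, Matrix.of_apply, Pi.basisFun_repr, Pi.basisFun_apply, Matrix.toLin'_apply,
      Matrix.mulVec_single_one, Matrix.col_apply]
    exact hA.matrix_elem _ _
  · rw [AlgEquiv.spectrum_eq]
    exact exists_spectralRadius_toReal_eq_norm _

end SpectralRadiusContinuity

/-! ### Entrywise holomorphy of matrix operations. -/

section EntrywiseDifferentiable

open Matrix

variable {l m p : Type*} [Fintype m]

theorem differentiableAt_mul_apply {A : ℂ → Matrix l m ℂ} {B : ℂ → Matrix m p ℂ} {z : ℂ}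
    (hA : ∀ i j, DifferentiableAt ℂ (fun z => A z i j) z)
    (hB : ∀ i j, DifferentiableAt ℂ (fun z => B z i j) z) (i : l) (j : p) :
    DifferentiableAt ℂ (fun z => (A z * B z) i j) z := by
  simp only [Matrix.mul_apply]
  exact DifferentiableAt.fun_sum fun k _ => (hA i k).mul (hB k j)

variable [DecidableEq m]

theorem differentiableAt_det {A : ℂ → Matrix m m ℂ} {z : ℂ}
    (hA : ∀ i j, DifferentiableAt ℂ (fun z => A z i j) z) :
    DifferentiableAt ℂ (fun z => (A z).det) z := by
  simp only [Matrix.det_apply]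
  exact DifferentiableAt.fun_sum fun σ _ =>
    (DifferentiableAt.fun_finsetProd fun i _ => hA _ _).const_smul _

theorem differentiableAt_inv_apply {A : ℂ → Matrix m m ℂ} {z : ℂ}
    (hA : ∀ i j, DifferentiableAt ℂ (fun z => A z i j) z) (hdet : (A z).det ≠ 0) (i j : m) :
    DifferentiableAt ℂ (fun z => (A z)⁻¹ i j) z := by
  simp only [Matrix.inv_def, Ring.inverse_eq_inv', Matrix.smul_apply, smul_eq_mul,
    Matrix.adjugate_apply]
  refine ((differentiableAt_det hA).inv hdet).mul (differentiableAt_det fun k q => ?_)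
  by_cases hk : k = j
  · subst hk
    simp
  · simpa [Matrix.updateRow_ne hk] using hA k q

theorem differentiableAt_pow_apply {A : ℂ → Matrix m m ℂ} {z : ℂ}
    (hA : ∀ i j, DifferentiableAt ℂ (fun z => A z i j) z) (k : ℕ) (i j : m) :
    DifferentiableAt ℂ (fun z => (A z ^ k) i j) z := by
  induction k generalizing i j with
  | zero => simp
  | succ k ih =>
    simp only [pow_succ]
    exact differentiableAt_mul_apply ih hA i j

theorem differentiableAt_list_prod_apply {ι : Type*} (L : List ι) {A : ι → ℂ → Matrix m m ℂ} {z : ℂ}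
    (hA : ∀ a i j, DifferentiableAt ℂ (fun z => A a z i j) z) (i j : m) :
    DifferentiableAt ℂ (fun z => (L.map fun a => A a z).prod i j) z := by
  induction L generalizing i j with
  | nil => simp
  | cons a L ih =>
    simp only [List.map_cons, List.prod_cons]
    exact differentiableAt_mul_apply (hA a) ih i j

variable {c d : ℕ}

theorem differentiableAt_scalingMatrix_apply (z : ℂ) (i j : Fin c ⊕ Fin d) :
    DifferentiableAt ℂ (fun z => scalingMatrix c d z i j) z := by
  rcases i with i | i <;> rcases j with j | j <;> simp [scalingMatrix]

theorem differentiableAt_cocycleMatrix_apply {n : ℕ}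
    (T : Fin n → Matrix (Fin c ⊕ Fin d) (Fin c ⊕ Fin d) ℂ) (z : ℂ) (i j : Fin c ⊕ Fin d) :
    DifferentiableAt ℂ (fun z => cocycleMatrix T z i j) z := by
  simp only [cocycleMatrix, List.ofFn_eq_map]
  exact differentiableAt_list_prod_apply _ (A := fun a z => scalingMatrix c d z * T a)
    (fun a => differentiableAt_mul_apply (differentiableAt_scalingMatrix_apply z)
      fun i j => differentiableAt_const (T a i j)) i j

theorem differentiableAt_graphMatrix_apply {A : ℂ → Matrix (Fin c ⊕ Fin d) (Fin c ⊕ Fin d) ℂ}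
    {z : ℂ} (hA : ∀ i j, DifferentiableAt ℂ (fun z => A z i j) z)
    (hdet : (A z).toBlocks₂₂.det ≠ 0) (i : Fin c) (j : Fin d) :
    DifferentiableAt ℂ (fun z => graphMatrix (A z) i j) z :=
  differentiableAt_mul_apply (fun i j => hA (Sum.inl i) (Sum.inr j))
    (differentiableAt_inv_apply (fun i j => hA (Sum.inr i) (Sum.inr j)) hdet) i j

end EntrywiseDifferentiable

/-! ### Holomorphy of W and the main theorem. -/

section Main

open Filter Matrix

variable {c d : ℕ}

namespace IsStrictLyapunov

variable {f : Module.End ℂ (Fin c ⊕ Fin d → ℂ)} {s : ℝ}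

/-- On an eigenvector, Q(f v) = |μ|² Q(v) < s² Q(v), so the sign of Q(v) decides on which side of s
the modulus |μ| lies. -/
theorem exteriorSpectralRadius_eq (h : IsStrictLyapunov f s signatureForm)
    (hW : ∀ v ∈ unstableSubspace f s, f v ∈ unstableSubspace f s) :
    exteriorSpectralRadius d f = ‖LinearMap.det (f.restrict hW)‖ := by
  refine exteriorSpectralRadius_eq_norm_det h.isCompl.symm hW
    (fun v hv => map_mem_biSup_maxGenEigenspace f _ hv) h.pos.le (fun μ hμ => ?_) (fun μ hμ => ?_)
    h.finrank_unstableSubspace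
  · obtain ⟨v, hv⟩ := hμ.exists_hasEigenvector
    have hv0 : (v : Fin c ⊕ Fin d → ℂ) ≠ 0 := fun h0 => hv.2 (Subtype.ext h0)
    have h1 := h.lt v hv0
    have h2 : f v = μ • (v : Fin c ⊕ Fin d → ℂ) := congrArg Subtype.val hv.apply_eq_smul
    rw [h2, h.smul] at h1
    by_contra hlt
    nlinarith [h.neg_of_mem_unstableSubspace v.2 hv0, norm_nonneg μ, h.pos,
      pow_lt_pow_left₀ (not_le.1 hlt) (norm_nonneg μ) two_ne_zero]
  · obtain ⟨v, hv⟩ := hμ.exists_hasEigenvector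
    have hv0 : (v : Fin c ⊕ Fin d → ℂ) ≠ 0 := fun h0 => hv.2 (Subtype.ext h0)
    have h1 := h.lt v hv0
    have h2 : f v = μ • (v : Fin c ⊕ Fin d → ℂ) := congrArg Subtype.val hv.apply_eq_smul
    rw [h2, h.smul] at h1
    by_contra hlt
    nlinarith [h.nonneg_of_mem_stableSubspace v.2, norm_nonneg μ, h.pos,
      pow_lt_pow_left₀ (not_le.1 hlt) h.pos.le two_ne_zero]

theorem det_restrict_unstableSubspace_ne_zero (h : IsStrictLyapunov f s signatureForm)
    (hW : ∀ v ∈ unstableSubspace f s, f v ∈ unstableSubspace f s) :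
    LinearMap.det (f.restrict hW) ≠ 0 := by
  intro h0
  obtain ⟨v, hv, hv0⟩ := (Submodule.ne_bot_iff _).1 (LinearMap.bot_lt_ker_of_det_eq_zero h0).ne'
  have hv1 : (v : Fin c ⊕ Fin d → ℂ) ≠ 0 := fun h0 => hv0 (Subtype.ext h0)
  have h1 := h.lt v hv1
  have h2 : f v = 0 := congrArg Subtype.val (LinearMap.mem_ker.1 hv)
  rw [h2, h.map_zero] at h1
  nlinarith [h.neg_of_mem_unstableSubspace v.2 hv1, pow_pos h.pos 2]

end IsStrictLyapunov

theorem isStrictLyapunov_cocycleEnd {n : ℕ} (hn : 0 < n)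
    {T : Fin n → Matrix (Fin c ⊕ Fin d) (Fin c ⊕ Fin d) ℂ}
    (hT : ∀ j, T j ∈ pseudoUnitary c d) {z : ℂ} (hz : ‖z‖ < 1) :
    IsStrictLyapunov (cocycleEnd T z) (separatingRate n z) signatureForm :=
  ⟨separatingRate_pos n z, continuous_signatureForm, signatureForm_smul,
    fun _ hv => signatureForm_cocycleEnd_lt hn hT hz hv⟩

theorem differentiableOn_of_unstableSubspace_eq_range_graphMap {n : ℕ} (hn : 0 < n)
    {T : Fin n → Matrix (Fin c ⊕ Fin d) (Fin c ⊕ Fin d) ℂ}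
    (hT : ∀ j, T j ∈ pseudoUnitary c d) {K : ℂ → Matrix (Fin c) (Fin d) ℂ}
    (hK : ∀ z ∈ Metric.ball (0 : ℂ) 1, unstableSubspace (cocycleEnd T z) (separatingRate n z) =
      LinearMap.range (graphMap 1 (K z))) (i : Fin c) (j : Fin d) :
    DifferentiableOn ℂ (fun z => K z i j) (Metric.ball 0 1) := by
  have hL : ∀ z ∈ Metric.ball (0 : ℂ) 1,
      IsStrictLyapunov (cocycleEnd T z) (separatingRate n z) signatureForm := fun z hz =>
    isStrictLyapunov_cocycleEnd hn hT (mem_ball_zero_iff.1 hz)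
  have hA : ∀ k, ∀ z ∈ Metric.ball (0 : ℂ) 1, ∀ v, signatureForm ((cocycleMatrix T z ^ k) *ᵥ v) ≤
      (separatingRate n z ^ k) ^ 2 * signatureForm v := fun k z hz v => by
    have := (hL z hz).pow_le v k
    rwa [cocycleEnd, ← Matrix.toLin'_pow, Matrix.toLin'_apply] at this
  refine differentiableOn_of_tendsto_of_norm_le Metric.isOpen_ball (C := 1)
    (F := fun k z => graphMatrix (cocycleMatrix T z ^ k) i j) (fun k z hz => ?_)
    (fun k z hz => norm_graphMatrix_apply_le (pow_pos (separatingRate_pos n z) k) (hA k z hz) i j)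
    fun z hz => ?_
  · exact (differentiableAt_graphMatrix_apply
      (differentiableAt_pow_apply (differentiableAt_cocycleMatrix_apply T z) k)
      (det_toBlocks₂₂_ne_zero (pow_pos (separatingRate_pos n z) k) (hA k z hz))
      i j).differentiableWithinAt
  · simpa [cocycleEnd] using (hL z hz).tendsto_graphMatrix_pow (hK z hz) i j

theorem graphMap_apply (g : GL (Fin c ⊕ Fin d) ℂ) (M : Matrix (Fin c) (Fin d) ℂ)
    (x : Fin d → ℂ) : graphMap g M x = g.val *ᵥ Sum.elim (M *ᵥ x) x := by
  simp [graphMap, Matrix.fromRows_mulVec]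

theorem GeneralLinearGroup.inv_mulVec_mulVec (g : GL (Fin c ⊕ Fin d) ℂ) (v : Fin c ⊕ Fin d → ℂ) :
    (g⁻¹).val *ᵥ (g.val *ᵥ v) = v := by
  rw [Matrix.mulVec_mulVec, Units.inv_mul, Matrix.one_mulVec]

theorem GeneralLinearGroup.mulVec_inv_mulVec (g : GL (Fin c ⊕ Fin d) ℂ) (v : Fin c ⊕ Fin d → ℂ) :
    g.val *ᵥ ((g⁻¹).val *ᵥ v) = v := by
  rw [Matrix.mulVec_mulVec, Units.mul_inv, Matrix.one_mulVec]

/-- In the chart of g the graph becomes g⁻¹[K; 1] = [N₁; N₂], with coordinate N₁N₂⁻¹. The block N₂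
is invertible at z₀ because the point lies in the chart, hence also nearby. -/
theorem Grassmannian.holomorphicOn_param_one {K : ℂ → Matrix (Fin c) (Fin d) ℂ} {U : Set ℂ}
    (hU : IsOpen U) (hK : ∀ i j, DifferentiableOn ℂ (fun z => K z i j) U) :
    Grassmannian.HolomorphicOn (fun z => Grassmannian.param 1 (K z)) U := by
  rintro z₀ hz₀ g ⟨M₀, hM₀⟩
  let N : ℂ → Matrix (Fin c ⊕ Fin d) (Fin d) ℂ := fun z =>
    (g⁻¹).val * Matrix.fromRows (K z) (1 : Matrix (Fin d) (Fin d) ℂ)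
  have hN : ∀ z x, (g⁻¹).val *ᵥ Sum.elim (K z *ᵥ x) x =
      Sum.elim ((N z).toRows₁ *ᵥ x) ((N z).toRows₂ *ᵥ x) := by
    intro z x
    rw [← Matrix.fromRows_mulVec, Matrix.fromRows_toRows]
    simp only [N]
    rw [← Matrix.mulVec_mulVec, Matrix.fromRows_mulVec, Matrix.one_mulVec]
  have hNd : ∀ i j, DifferentiableAt ℂ (fun z => N z i j) z₀ := by
    refine differentiableAt_mul_apply (fun i j => differentiableAt_const _) fun i j => ?_
    rcases i with i | i
    · exact (hK i j).differentiableAt (hU.mem_nhds hz₀)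
    · exact differentiableAt_const _
  have hdet₀ : (N z₀).toRows₂.det ≠ 0 := by
    intro h0
    obtain ⟨x, hx, hx0⟩ := Matrix.exists_mulVec_eq_zero_iff.2 h0
    have hmem : graphMap 1 (K z₀) x ∈ LinearMap.range (graphMap g M₀) := by
      have : LinearMap.range (graphMap g M₀) = LinearMap.range (graphMap 1 (K z₀)) :=
        congrArg Subtype.val hM₀
      rw [this]
      exact ⟨x, rfl⟩
    obtain ⟨y, hy⟩ := hmem
    rw [graphMap_apply, graphMap_one_apply] at hy
    have h1 := congrArg ((g⁻¹).val *ᵥ ·) hy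
    simp only [GeneralLinearGroup.inv_mulVec_mulVec] at h1
    rw [hN, hx0] at h1
    have hy0 : y = 0 := funext fun j => congrFun h1 (Sum.inr j)
    rw [hy0, Matrix.mulVec_zero, Sum.elim_zero_zero, Matrix.mulVec_zero] at hy
    exact hx (funext fun j => (congrFun hy (Sum.inr j)).symm)
  have hQ : ∀ i j, DifferentiableAt ℂ (fun z => (N z).toRows₂ i j) z₀ := fun i j => hNd _ _
  refine ⟨fun z => (N z).toRows₁ * (N z).toRows₂⁻¹, ?_,
    differentiableAt_mul_apply (fun i j => hNd _ _) (differentiableAt_inv_apply hQ hdet₀)⟩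
  filter_upwards [(differentiableAt_det hQ).continuousAt.eventually_ne hdet₀] with z hz
  refine Subtype.ext (Submodule.eq_of_le_of_finrank_eq ?_ ?_)
  · rintro _ ⟨x, rfl⟩
    refine ⟨(N z).toRows₂ *ᵥ x, ?_⟩
    rw [graphMap_apply, Matrix.mulVec_mulVec, Matrix.mul_assoc,
      Matrix.nonsing_inv_mul _ hz.isUnit, Matrix.mul_one, ← hN,
      GeneralLinearGroup.mulVec_inv_mulVec, graphMap_one_apply]
  · exact (Grassmannian.param 1 (K z)).2.trans (Grassmannian.param g _).2.symm

/-- The determinant of the restriction of `A` to the invariant graph of `K`. -/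
theorem det_restrict_range_graphMap (A : Matrix (Fin c ⊕ Fin d) (Fin c ⊕ Fin d) ℂ)
    (K : Matrix (Fin c) (Fin d) ℂ)
    (hW : ∀ v ∈ LinearMap.range (graphMap 1 K), Matrix.toLin' A v ∈ LinearMap.range (graphMap 1 K)) :
    LinearMap.det ((Matrix.toLin' A).restrict hW) =
      (A * Matrix.fromRows K (1 : Matrix (Fin d) (Fin d) ℂ)).toRows₂.det := by
  have hinj : Function.Injective (graphMap 1 K) := fun x y h => by
    rw [graphMap_one_apply, graphMap_one_apply] at h
    exact funext fun j => congrFun h (Sum.inr j)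
  let e := LinearEquiv.ofInjective (graphMap 1 K) hinj
  set X := (A * Matrix.fromRows K (1 : Matrix (Fin d) (Fin d) ℂ)).toRows₂ with hX
  have hcomm : ∀ x, (Matrix.toLin' A).restrict hW (e x) = e (X *ᵥ x) := by
    intro x
    apply Subtype.ext
    obtain ⟨y, hy⟩ := hW _ (e x).2
    have hAx : Matrix.toLin' A (e x) =
        (A * Matrix.fromRows K (1 : Matrix (Fin d) (Fin d) ℂ)) *ᵥ x := by
      rw [LinearEquiv.ofInjective_apply, Matrix.toLin'_apply, graphMap_one_apply,
        ← Matrix.mulVec_mulVec, Matrix.fromRows_mulVec, Matrix.one_mulVec]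
    have hyX : y = X *ᵥ x := by
      rw [hAx, graphMap_one_apply] at hy
      exact funext fun j => congrFun hy (Sum.inr j)
    rw [LinearMap.coe_restrict_apply, ← hy, hyX]
    rfl
  have hconj : (Matrix.toLin' A).restrict hW =
      (e : (Fin d → ℂ) →ₗ[ℂ] _) ∘ₗ Matrix.toLin' X ∘ₗ (e.symm : _ →ₗ[ℂ] (Fin d → ℂ)) := by
    refine LinearMap.ext fun w => ?_
    obtain ⟨x, rfl⟩ := e.surjective w
    rw [hcomm]
    simp
  rw [hconj, LinearMap.det_conj, LinearMap.det_toLin']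

end Main

theorem mainTheorem6 (c d n : ℕ) (hn : 0 < n)
    (T : Fin n → Matrix (Fin c ⊕ Fin d) (Fin c ⊕ Fin d) ℂ)
    (hT : ∀ j, T j ∈ pseudoUnitary c d) :
    (∃ W : ℂ → Grassmannian c d,
      Grassmannian.HolomorphicOn W (Metric.ball 0 1) ∧
      ∃ hW : ∀ z ∈ Metric.ball (0 : ℂ) 1, ∀ v ∈ (W z).1, cocycleEnd T z v ∈ (W z).1,
        ∀ (z : ℂ) (hz : z ∈ Metric.ball (0 : ℂ) 1),
          (∃ r : ℝ, (W z).1 =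
            ⨆ μ ∈ {μ : ℂ | r < ‖μ‖}, (cocycleEnd T z).maxGenEigenspace μ) ∧
          LinearMap.det ((cocycleEnd T z).restrict (hW z hz)) ≠ 0 ∧
          Real.log (exteriorSpectralRadius d (cocycleEnd T z)) =
            Real.log ‖LinearMap.det ((cocycleEnd T z).restrict (hW z hz))‖) ∧
    (∀ z ∈ Metric.closedBall (0 : ℂ) 1, 0 < exteriorSpectralRadius d (cocycleEnd T z)) ∧
    InnerProductSpace.HarmonicOnNhd
      (fun z : ℂ => Real.log (exteriorSpectralRadius d (cocycleEnd T z))) (Metric.ball 0 1) ∧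
    ContinuousOn (fun z : ℂ => Real.log (exteriorSpectralRadius d (cocycleEnd T z)))
      (Metric.closedBall 0 1) := by
  have hL : ∀ z ∈ Metric.ball (0 : ℂ) 1,
      IsStrictLyapunov (cocycleEnd T z) (separatingRate n z) signatureForm := fun z hz =>
    isStrictLyapunov_cocycleEnd hn hT (mem_ball_zero_iff.1 hz)
  have hex : ∀ z, ∃ K : Matrix (Fin c) (Fin d) ℂ, z ∈ Metric.ball (0 : ℂ) 1 →
      unstableSubspace (cocycleEnd T z) (separatingRate n z) = LinearMap.range (graphMap 1 K) := by
    intro z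
    by_cases hz : z ∈ Metric.ball (0 : ℂ) 1
    · obtain ⟨K, hK⟩ := (hL z hz).exists_unstableSubspace_eq_range_graphMap
      exact ⟨K, fun _ => hK⟩
    · exact ⟨0, fun h => absurd h hz⟩
  choose K hK using hex
  have hKd := differentiableOn_of_unstableSubspace_eq_range_graphMap hn hT hK
  have hW : ∀ z ∈ Metric.ball (0 : ℂ) 1, ∀ v ∈ (Grassmannian.param 1 (K z)).1,
      cocycleEnd T z v ∈ (Grassmannian.param 1 (K z)).1 := by
    intro z hz v hv
    change v ∈ LinearMap.range (graphMap 1 (K z)) at hv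
    change cocycleEnd T z v ∈ LinearMap.range (graphMap 1 (K z))
    rw [← hK z hz] at hv ⊢
    exact map_mem_biSup_maxGenEigenspace _ _ hv
  have hradius : ∀ (z : ℂ) (hz : z ∈ Metric.ball (0 : ℂ) 1),
      LinearMap.det ((cocycleEnd T z).restrict (hW z hz)) ≠ 0 ∧
        exteriorSpectralRadius d (cocycleEnd T z) =
          ‖LinearMap.det ((cocycleEnd T z).restrict (hW z hz))‖ := by
    intro z hz
    -- The subspace is generalized because the restriction of D(z) depends on it, so the equality
    -- cannot simply be rewritten.
    have key : ∀ (W : Submodule ℂ (Fin c ⊕ Fin d → ℂ))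
        (_ : unstableSubspace (cocycleEnd T z) (separatingRate n z) = W)
        (hW : ∀ v ∈ W, cocycleEnd T z v ∈ W),
        LinearMap.det ((cocycleEnd T z).restrict hW) ≠ 0 ∧
          exteriorSpectralRadius d (cocycleEnd T z) =
            ‖LinearMap.det ((cocycleEnd T z).restrict hW)‖ := by
      rintro _ rfl hW
      exact ⟨(hL z hz).det_restrict_unstableSubspace_ne_zero hW,
        (hL z hz).exteriorSpectralRadius_eq hW⟩
    exact key _ (hK z hz) (hW z hz)
  have hpos : ∀ z ∈ Metric.closedBall (0 : ℂ) 1,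
      0 < exteriorSpectralRadius d (cocycleEnd T z) := by
    intro z hz
    -- D(0) is singular when c > 0, so positivity at 0 comes from the determinant on W(0); elsewhere
    -- D(z) is invertible.
    by_cases hz0 : z = 0
    · subst hz0
      obtain ⟨h1, h2⟩ := hradius 0 (Metric.mem_ball_self one_pos)
      rw [h2]
      exact norm_pos_iff.2 h1
    · refine exteriorSpectralRadius_pos (by simp) ?_
      exact (isUnit_cocycleMatrix hT hz0).map (Matrix.toLinAlgEquiv' (R := ℂ))
  refine ⟨⟨fun z => Grassmannian.param 1 (K z),
    Grassmannian.holomorphicOn_param_one Metric.isOpen_ball hKd, hW, fun z hz =>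
      ⟨⟨separatingRate n z, (hK z hz).symm⟩, (hradius z hz).1, by rw [(hradius z hz).2]⟩⟩,
    hpos, fun z hz => ?_, ?_⟩
  · let g : ℂ → ℂ := fun z =>
      (cocycleMatrix T z * Matrix.fromRows (K z) (1 : Matrix (Fin d) (Fin d) ℂ)).toRows₂.det
    have hg : ∀ (z : ℂ) (hz : z ∈ Metric.ball (0 : ℂ) 1),
        LinearMap.det ((cocycleEnd T z).restrict (hW z hz)) = g z := fun z hz =>
      det_restrict_range_graphMap (cocycleMatrix T z) (K z) (hW z hz)
    have hgd : DifferentiableOn ℂ g (Metric.ball 0 1) := by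
      intro w hw
      refine (differentiableAt_det fun i j => ?_).differentiableWithinAt
      refine differentiableAt_mul_apply (differentiableAt_cocycleMatrix_apply T w)
        (fun i j => ?_) (Sum.inr i) j
      rcases i with i | i
      · exact (hKd i j).differentiableAt (Metric.isOpen_ball.mem_nhds hw)
      · exact differentiableAt_const _
    have hg0 : g z ≠ 0 := hg z hz ▸ (hradius z hz).1
    refine (InnerProductSpace.harmonicAt_congr_nhds ?_).1
      ((hgd.analyticAt (Metric.isOpen_ball.mem_nhds hz)).harmonicAt_log_norm hg0)
    filter_upwards [Metric.isOpen_ball.mem_nhds hz] with w hw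
    rw [(hradius w hw).2, hg w hw]
  · have hcont : Continuous (cocycleMatrix T) := continuous_matrix fun i j =>
      continuous_iff_continuousAt.2 fun z =>
        (differentiableAt_cocycleMatrix_apply T z i j).continuousAt
    exact (continuous_exteriorSpectralRadius (by simp) hcont).continuousOn.log
      fun z hz => (hpos z hz).ne'
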